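/- Let $d\ge 2$, $\alpha>d$ and $J>0$. Write $|x-y|$ for the $\ell^1$-distance on $\mathbb Z^d$, and put $J_{xy}=J|x-y|^{-\alpha}$ for $x\ne y$, $J_{xx}=0$. Connectedness in $\mathbb Z^d$ is with respect to nearest neighbours. For a finite $\Lambda\subset\mathbb Z^d$ let $\Omega^-_\Lambda$ be the set of $\sigma\in\{-1,+1\}^{\mathbb Z^d}$ with $\sigma_x=-1$ for all $x\notin\Lambda$, and let $$H^-_\Lambda(\sigma)=-\sum_{\{x,y\}\subset\Lambda}J_{xy}\sigma_x\sigma_y+\sum_{x\in\Lambda,\,y\notin\Lambda}J_{xy}\sigma_x ,\qquad F_S=\sum_{x\in S,\,y\notin S}J_{xy}\quad(S\subset\mathbb Z^d\text{ finite}).$$ For a finite $S\subset\mathbb Z^d$ let $V(S)$ be the complement of the unbounded connected component of $S^c$, and let $\partial_{\mathrm{in}}S$ be the set of points of $S$ with a nearest neighbour outside $S$. Let $\mathrm{diam}(S)$ be the $\ell^1$-diameter, with the convention that $\mathrm{diam}(S)\geq 1$, i.e. a single point has diameter $1$. The boundary $\partial\sigma$ of a configuration $\sigma$ is the set of points $x$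 such that $\sigma$ is not constant on $\{y:|x-y|\le 1\}$. Fix $\varepsilon>0$ and put $a=\max\{\frac{d+1+\varepsilon}{\alpha-d},\,d+1+\varepsilon\}$, $r=\lceil\log_2(a+1)\rceil+d+1$. For $M>0$, an $(M,a,r)$-partition of a finite $\partial\sigma$ is a partition of $\partial\sigma$ into non-empty sets such that (A) for distinct parts $\overline\gamma,\overline\gamma'$ the set $\overline\gamma'$ is contained in a single connected component of $\overline\gamma^{\,c}$; (B) every part can be written as a union $\overline\gamma=\bigcup_{k=1}^{n}\overline\gamma_k$ with $1\le n\le 2^r-1$ in such a way that for all distinct parts $\overline\gamma,\overline\gamma'$ $$\mathrm{dist}(\overline\gamma,\overline\gamma')>M\min\Bigl\{\max_k\mathrm{diam}(\overline\gamma_k),\ \max_j\mathrm{diam}(\overline\gamma'_j)\Bigr\}^a .$$ Suppose that for every $\sigma$ with finite boundary an $(M,a,r)$-partition of $\partial\sigma$ has been chosen (for instance the finest one). The contours $\gamma$ of $\sigma$ are the pairs consisting of a part $\mathrm{sp}(\gamma)=\overline\gamma$ of the chosen partition and its label, which assigns to the unbounded component of $\overline\gamma^{\,c}$ the sign of $\sigma$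 on $\partial_{\mathrm{in}}V(\overline\gamma)$ and to each bounded component $C$ of $\overline\gamma^{\,c}$ the sign of $\sigma$ on $\partial_{\mathrm{in}}V(C)$. Let $|\gamma|=|\mathrm{sp}(\gamma)|$, let $\mathrm I_\pm(\gamma)$ be the union of the bounded components with label $\pm1$, and let $V(\gamma)=\mathrm{sp}(\gamma)\cup \mathrm I_+(\gamma)\cup\mathrm I_-(\gamma)$. Let $\mathcal E^-_\Lambda$ be the set of contours $\gamma$ such that some configuration has $\gamma$ as its only contour, the label of the unbounded component is $-1$, and $V(\gamma)\subset\Lambda$. For $\gamma\in\mathcal E_\Lambda^-$ let $\Omega(\gamma)$ be the set of $\sigma\in\Omega^-_\Lambda$ that have $\gamma$ among their contours, and for $\sigma\in\Omega(\gamma)$ let $\tau(\sigma)$ be the configuration with $\tau(\sigma)_x=-1$ on $\mathrm{sp}(\gamma)$, $\tau(\sigma)_x=-\sigma_x$ on $\mathrm I_+(\gamma)$, and $\tau(\sigma)_x=\sigma_x$ elsewhere. Then there are constants $c_2,c_3,c_4>0$, depending only on $\alpha$, $d$ and the coupling strength $J$, such that for every $\varepsilon>0$, for all sufficiently large $M$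 and every such choice of partitions, for every finite $\Lambda\subset\mathbb Z^d$, every $\gamma\in\mathcal E^-_\Lambda$ and every $\sigma\in\Omega(\gamma)$, $$H^-_\Lambda(\sigma)-H^-_\Lambda(\tau(\sigma))\ \ge\ c_2|\gamma|+c_3F_{\mathrm I_+(\gamma)}+c_4F_{\mathrm{sp}(\gamma)} .$$ -/

import Mathlib

noncomputable section

open scoped Classical

namespace LongRangeIsing

/-! ### The lattice -/

/-- The sites of the lattice `ℤ^d`. -/
abbrev Site (d : ℕ) : Type := Fin d → ℤ

/-- Configurations in `{-1,+1}^{ℤ^d}`; the units of `ℤ` are exactly `1` and `-1`. -/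
abbrev Config (d : ℕ) : Type := Site d → ℤˣ

/-- The `ℓ¹`-distance `|x - y|` on `ℤ^d`. -/
def dist1 {d : ℕ} (x y : Site d) : ℕ := ∑ i, (x i - y i).natAbs

/-- The nearest-neighbour graph on `ℤ^d`. -/
def lattice (d : ℕ) : SimpleGraph (Site d) where
  Adj x y := dist1 x y = 1
  symm := ⟨fun x y h => by
    have : dist1 y x = dist1 x y := by
      unfold dist1
      exact Finset.sum_congr rfl fun i _ => by omega
    rw [this]; exact h⟩
  loopless := ⟨fun x h => by simp [dist1] at h⟩

/-- The connected components of a subset `S` of `ℤ^d`. -/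
abbrev Comp {d : ℕ} (S : Set (Site d)) : Type := ((lattice d).induce S).ConnectedComponent

/-- A connected component of `S`, as a set of sites. -/
def Comp.sites {d : ℕ} {S : Set (Site d)} (C : Comp S) : Set (Site d) := Subtype.val '' C.supp

/-- The volume `V(S)`: the complement of the unbounded component of the complement of `S`. -/
def vol {d : ℕ} (S : Set (Site d)) : Set (Site d) :=
  (⋃ C ∈ {C : Comp Sᶜ | C.sites.Infinite}, C.sites)ᶜ

/-- The inner boundary: the points of `S` at distance `1` from the complement of `S`. -/
def innerBoundary {d : ℕ} (S : Set (Site d)) : Set (Site d) :=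
  {x | x ∈ S ∧ ∃ y, y ∉ S ∧ dist1 x y = 1}

/-- The `ℓ¹`-diameter of a finite set, with the convention that it is at least `1`
(so that a single point has diameter `1`). -/
def diam {d : ℕ} (A : Finset (Site d)) : ℕ := max 1 ((A ×ˢ A).sup fun p => dist1 p.1 p.2)

/-! ### The model -/

/-- The coupling constants `J_{xy} = J / |x-y|^α` for `x ≠ y`, and `J_{xx} = 0`. -/
def coupling {d : ℕ} (J α : ℝ) (x y : Site d) : ℝ :=
  if x = y then 0 else J / (dist1 x y : ℝ) ^ α

/-- The value of a spin as a real number. -/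
def spin (s : ℤˣ) : ℝ := ((s : ℤ) : ℝ)

/-- The Hamiltonian in `Λ` with boundary condition `ω` and field `h`. In the first sum every
unordered pair is counted twice, and the diagonal vanishes. -/
def hamiltonian {d : ℕ} (J α : ℝ) (h : Site d → ℝ) (ω : Config d) (Λ : Finset (Site d))
    (σ : Config d) : ℝ :=
  -((1 / 2 : ℝ) * ∑ x ∈ Λ, ∑ y ∈ Λ, coupling J α x y * spin (σ x) * spin (σ y))
    - (∑ x ∈ Λ, ∑' y : {y : Site d // y ∉ Λ}, coupling J α x y * spin (σ x) * spin (ω y))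
    - ∑ x ∈ Λ, h x * spin (σ x)

/-- The Hamiltonian `H_Λ^-` with zero field and `-` boundary condition. -/
def hamiltonianMinus {d : ℕ} (J α : ℝ) (Λ : Finset (Site d)) (σ : Config d) : ℝ :=
  hamiltonian J α (fun _ => 0) (fun _ => -1) Λ σ

/-- The surface energy `F_S`, the sum of `J_{xy}` over `x ∈ S` and `y ∉ S` (`S` finite). -/
def surfaceEnergy {d : ℕ} (J α : ℝ) (S : Set (Site d)) : ℝ :=
  ∑' x : S, ∑' y : (Sᶜ : Set (Site d)), coupling J α (x : Site d) (y : Site d)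

/-- The set `Ω_Λ^-` of configurations equal to `-1` outside `Λ`. -/
def configsMinus {d : ℕ} (Λ : Finset (Site d)) : Set (Config d) :=
  {σ | ∀ x, x ∉ Λ → σ x = -1}

/-! ### Contours -/

/-- `x` is `s`-correct for `σ` if `σ = s` on the closed unit ball around `x`. -/
def IsCorrect {d : ℕ} (σ : Config d) (s : ℤˣ) (x : Site d) : Prop :=
  ∀ y, dist1 x y ≤ 1 → σ y = s

/-- The boundary `∂σ`: the points that are neither `+`-correct nor `-`-correct. -/
def boundary {d : ℕ} (σ : Config d) : Set (Site d) :=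
  {x | ¬ IsCorrect σ 1 x ∧ ¬ IsCorrect σ (-1) x}

/-- The largest diameter in a family of finite sets. -/
def maxDiam {d : ℕ} (F : Finset (Finset (Site d))) : ℕ := F.sup diam

/-- `P` is an `(M,a,r)`-partition of `∂σ` (which is then finite). -/
structure IsMARPartition {d : ℕ} (M a r : ℝ) (σ : Config d)
    (P : Finset (Finset (Site d))) : Prop where
  nonempty : ∀ g ∈ P, g.Nonempty
  cover : (⋃ g ∈ P, (g : Set (Site d))) = boundary σ
  disjoint : ∀ g ∈ P, ∀ g' ∈ P, g ≠ g' → Disjoint g g'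
  oneComponent : ∀ g ∈ P, ∀ g' ∈ P, g ≠ g' →
    ∃ C : Comp (g : Set (Site d))ᶜ, (g' : Set (Site d)) ⊆ C.sites
  separated : ∃ fam : Finset (Site d) → Finset (Finset (Site d)),
    (∀ g ∈ P, (fam g).Nonempty ∧ ((fam g).card : ℝ) ≤ (2 : ℝ) ^ r - 1 ∧ (fam g).sup id = g) ∧
    ∀ g ∈ P, ∀ g' ∈ P, g ≠ g' → ∀ x ∈ g, ∀ y ∈ g',
      M * (min (maxDiam (fam g)) (maxDiam (fam g')) : ℝ) ^ a < (dist1 x y : ℝ)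

/-- A contour: a finite support together with a sign for every connected component of the
complement of the support. -/
structure Contour (d : ℕ) where
  sp : Finset (Site d)
  lab : Comp (sp : Set (Site d))ᶜ → ℤˣ

/-- The sign of `σ` on a set on which it is constant. -/
def signOn {d : ℕ} (σ : Config d) (S : Set (Site d)) : ℤˣ :=
  if ∀ x ∈ S, σ x = 1 then 1 else -1

/-- The label of `g`: on the unbounded component of the complement of `g` the sign of `σ` on the
inner boundary of `V(g)`, on a bounded component `C` the sign of `σ` on the inner boundary
of `V(C)`. -/
def labelOf {d : ℕ} (σ : Config d) (g : Finset (Site d)) (C : Comp (g : Set (Site d))ᶜ) : ℤˣ :=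
  if C.sites.Infinite then signOn σ (innerBoundary (vol (g : Set (Site d))))
  else signOn σ (innerBoundary (vol C.sites))

/-- A choice of an `(M,a,r)`-partition `Γ(σ)` for every configuration with finite boundary. -/
def IsPartitionChoice {d : ℕ} (M a r : ℝ) (Γ : Config d → Finset (Finset (Site d))) : Prop :=
  ∀ σ : Config d, (boundary σ).Finite → IsMARPartition M a r σ (Γ σ)

/-- The contours of `σ`. -/
def contours {d : ℕ} (Γ : Config d → Finset (Finset (Site d))) (σ : Config d) :
    Set (Contour d) :=
  (fun g => ⟨g, labelOf σ g⟩) '' (Γ σ : Set (Finset (Site d)))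

namespace Contour

variable {d : ℕ}

/-- The union of the bounded components of the complement of the support with label `s`. -/
def interior (γ : Contour d) (s : ℤˣ) : Set (Site d) :=
  ⋃ C ∈ {C : Comp (γ.sp : Set (Site d))ᶜ | C.sites.Finite ∧ γ.lab C = s}, C.sites

/-- The volume `V(γ)`. -/
def volume (γ : Contour d) : Set (Site d) :=
  (γ.sp : Set (Site d)) ∪ (γ.interior 1 ∪ γ.interior (-1))

/-- The contour has (outer) label `s`. -/
def HasLabel (γ : Contour d) (s : ℤˣ) : Prop :=
  ∀ C : Comp (γ.sp : Set (Site d))ᶜ, C.sites.Infinite → γ.lab C = s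

/-- An external connected component of the support. -/
def IsExternalComp (γ : Contour d) (K : Comp (γ.sp : Set (Site d))) : Prop :=
  ∀ K' : Comp (γ.sp : Set (Site d)), K' ≠ K →
    (vol K'.sites ∩ vol K.sites).Nonempty → vol K'.sites ⊆ vol K.sites

/-- `γ` is external in the family `G`: none of its external connected components is contained in
the volume of another contour of the family. -/
def IsExternalIn (γ : Contour d) (G : Set (Contour d)) : Prop :=
  ∀ γ' ∈ G, γ' ≠ γ → ∀ K : Comp (γ.sp : Set (Site d)), γ.IsExternalComp K →
    ¬ K.sites ⊆ γ'.volume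

end Contour

/-- A family of contours is compatible if it is the set of all contours of a configuration. -/
def IsCompatible {d : ℕ} (Γ : Config d → Finset (Finset (Site d))) (G : Set (Contour d)) : Prop :=
  ∃ ω : Config d, (boundary ω).Finite ∧ contours Γ ω = G

/-- The set of compatible families of external contours with label `s` contained in `Λ`. -/
def externalFamilies {d : ℕ} (Γ : Config d → Finset (Finset (Site d))) (s : ℤˣ)
    (Λ : Finset (Site d)) : Set (Set (Contour d)) :=
  {G | IsCompatible Γ G ∧
    ∀ γ ∈ G, γ.IsExternalIn G ∧ γ.HasLabel s ∧ γ.volume ⊆ (Λ : Set (Site d))}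

/-- The set `Ω(G)` of the configurations in `Ω_Λ^-` that have all contours of the family `G`. -/
def configsWith {d : ℕ} (Γ : Config d → Finset (Finset (Site d))) (Λ : Finset (Site d))
    (G : Set (Contour d)) : Set (Config d) :=
  {σ | σ ∈ configsMinus Λ ∧ G ⊆ contours Γ σ}

/-- The map `τ_G` that erases the contours of the family `G`. -/
def erase {d : ℕ} (G : Set (Contour d)) (σ : Config d) : Config d := fun x =>
  if x ∈ ⋃ γ ∈ G, (γ.sp : Set (Site d)) then -1
  else if x ∈ ⋃ γ ∈ G, γ.interior 1 then -σ x
  else σ x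

/-- The exponent `a = max {(d+1+ε)/(α-d), d+1+ε}`. -/
def aParam (d : ℕ) (α ε : ℝ) : ℝ := max ((d + 1 + ε) / (α - d)) (d + 1 + ε)

/-- The parameter `r = ⌈log₂(a+1)⌉ + d + 1`. -/
def rParam (d : ℕ) (α ε : ℝ) : ℝ := (⌈Real.logb 2 (aParam d α ε + 1)⌉ : ℝ) + d + 1

end LongRangeIsing

end

noncomputable section

open scoped Classical

namespace LongRangeIsing

variable {d : ℕ}

/-! ### The `ℓ¹`-metric -/

/-! Write `g` for the support, `A` for the interior with label +1, and `B` for the complement of `g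
∪ A`. Were every spin +1 on `A` and -1 on `B`, erasing the contour would gain twice the `A`-`B`
interaction, and on `g` the coupling of each site to the sites of opposite spin. The proof bounds
this gain from below and shows that the spins contradicting their label cost little.

Support: every site of `g` has a neighbour in `g` of opposite spin, so for each other site at least
one of the two disagrees with it. Up to the factor `2 ^ α * 3 ^ d`, the disagreeing interaction
therefore dominates the whole interaction of `g`, hence both `J * |g|` and the surface energy of `g`
(`sum_interaction_univ_le`).

Wrong spins: the sign changes of `σ` across the edges inside one part form a closed ℤ/2-valued edge
function, because the parts are more than 2 apart. On `ℤ^d` it is a gradient, constant on each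
component of the complement of that part. Up to a constant `σ` is the product of these primitives,
so a site whose spin contradicts the label of its component is separated from `g` by a single other
part `g'` (`IsMARPartition.exists_separating_part_of_ne_label`).

Let `m` be the largest diameter of a piece of `g'`. If `m` is at most the corresponding diameter of
`g`, the sites cut off by `g'` lie within `O(m)` of `g'`, whereas `g'` is at distance more than `M *
m ^ 3` from `g` and from the other parts of the same scale. Around each wrong site there is thus a
large box in the same region, with comparable couplings and few overlaps; summing over the scales
leaves a fraction `O(1 / M)` of the interaction (`IsSeparatedFamily.interaction_shadow_le`). If `g'`
is the larger one, its wrong sites are too far from `g` to lie in `A`; those in `B` are at distance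
at least `M * D ^ a` from `A`, with `D` the diameter attached to `g`, and `|A| = O(D ^ d)`, so the
choice of `a` makes their contribution small. Both estimates enter `IsSeparatedFamily.energy_le`.
For large `M` all errors are absorbed, and the surface energy of `A` is at most the `A`-`B`
interaction plus the surface energy of `g`. -/

lemma dist1_self (x : Site d) : dist1 x x = 0 := by simp [dist1]

lemma dist1_comm (x y : Site d) : dist1 x y = dist1 y x :=
  Finset.sum_congr rfl fun i _ => by omega

lemma dist1_triangle (x y z : Site d) : dist1 x z ≤ dist1 x y + dist1 y z := by
  unfold dist1
  rw [← Finset.sum_add_distrib]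
  exact Finset.sum_le_sum fun i _ => by omega

lemma dist1_pos {x y : Site d} (h : x ≠ y) : 0 < dist1 x y := by
  obtain ⟨i, hi⟩ := Function.ne_iff.mp h
  refine Finset.sum_pos' (fun _ _ => Nat.zero_le _) ⟨i, Finset.mem_univ i, by omega⟩

lemma natAbs_sub_le_dist1 (x y : Site d) (i : Fin d) : (x i - y i).natAbs ≤ dist1 x y :=
  Finset.single_le_sum (f := fun i => (x i - y i).natAbs) (fun _ _ => Nat.zero_le _)
    (Finset.mem_univ i)

lemma dist1_update (x y : Site d) (i : Fin d) (t : ℤ) :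
    dist1 (Function.update x i t) y + (x i - y i).natAbs = dist1 x y + (t - y i).natAbs := by
  unfold dist1
  rw [← Finset.add_sum_erase _ _ (Finset.mem_univ i),
    ← Finset.add_sum_erase _ (fun j => (x j - y j).natAbs) (Finset.mem_univ i)]
  have : ∑ j ∈ Finset.univ.erase i, (Function.update x i t j - y j).natAbs
      = ∑ j ∈ Finset.univ.erase i, (x j - y j).natAbs :=
    Finset.sum_congr rfl fun j hj => by
      rw [Function.update_of_ne (Finset.ne_of_mem_erase hj)]
  rw [this, Function.update_self]
  omega

lemma dist1_update_self (x : Site d) (i : Fin d) (t : ℤ) :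
    dist1 x (Function.update x i t) = (t - x i).natAbs := by
  have := dist1_update x x i t
  rw [dist1_self, dist1_comm] at this
  omega

lemma dist1_update_update (x : Site d) (i : Fin d) (s t : ℤ) :
    dist1 (Function.update x i s) (Function.update x i t) = (t - s).natAbs := by
  have := dist1_update_self (Function.update x i s) i t
  rwa [Function.update_idem, Function.update_self] at this

lemma dist1_add_left (x y z : Site d) : dist1 (x + y) (x + z) = dist1 y z := by
  simp [dist1]

/-- One step of a geodesic from `x` to `y`. -/
lemma exists_geodesic_step {x y : Site d} (h : x ≠ y) :
    ∃ z, dist1 x z = 1 ∧ dist1 z y + 1 = dist1 x y := by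
  obtain ⟨i, hi⟩ := Function.ne_iff.mp h
  rcases lt_or_gt_of_ne hi with hi | hi
  · refine ⟨Function.update x i (x i + 1), by rw [dist1_update_self]; simp, ?_⟩
    have := dist1_update x y i (x i + 1)
    omega
  · refine ⟨Function.update x i (x i - 1), by rw [dist1_update_self]; simp, ?_⟩
    have := dist1_update x y i (x i - 1)
    omega

/-- If `Q` can only be left through `g`, then some geodesic from a point of `Q` to a point
outside `Q` meets `g`. -/
lemma exists_mem_geodesic {g Q : Set (Site d)}
    (hQ : ∀ u v, u ∈ Q → dist1 u v = 1 → v ∉ g → v ∈ Q) {x y : Site d} (hx : x ∈ Q)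
    (hy : y ∉ Q) : ∃ z ∈ g, dist1 x z + dist1 z y = dist1 x y := by
  induction hn : dist1 x y generalizing x with
  | zero =>
    exact absurd hn (dist1_pos fun h : x = y => hy (h ▸ hx)).ne'
  | succ n ih =>
    have hxy : x ≠ y := fun h => hy (h ▸ hx)
    obtain ⟨z, hz1, hz2⟩ := exists_geodesic_step hxy
    by_cases hzg : z ∈ g
    · exact ⟨z, hzg, by omega⟩
    · obtain ⟨w, hw, hw2⟩ := ih (hQ x z hx hz1 hzg) (by omega)
      refine ⟨w, hw, le_antisymm ?_ ?_⟩
      · have := dist1_triangle x z w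
        omega
      · have := dist1_triangle x w y
        omega

/-- Moving along a coordinate direction without meeting `g`. -/
lemma update_mem_of_segment {g Q : Set (Site d)}
    (hQ : ∀ u v, u ∈ Q → dist1 u v = 1 → v ∉ g → v ∈ Q) {x : Site d} (hx : x ∈ Q) (i : Fin d)
    (t : ℤ) (h : ∀ s ∈ Set.uIcc (x i) t, Function.update x i s ∉ g) :
    Function.update x i t ∈ Q := by
  have key : ∀ n : ℕ, ∀ t : ℤ, (t - x i).natAbs = n →
      (∀ s ∈ Set.uIcc (x i) t, Function.update x i s ∉ g) → Function.update x i t ∈ Q := by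
    intro n
    induction n with
    | zero =>
      intro t ht _
      have : t = x i := by omega
      rw [this, Function.update_eq_self]
      exact hx
    | succ n ih =>
      intro t ht hs
      obtain ⟨u, hu1, hu2, hu3⟩ : ∃ u : ℤ, (u - x i).natAbs = n ∧ (t - u).natAbs = 1 ∧
          u ∈ Set.uIcc (x i) t := by
        rcases le_total (x i) t with h | h
        · exact ⟨t - 1, by omega, by omega, by rw [Set.uIcc_of_le h]; constructor <;> omega⟩
        · exact ⟨t + 1, by omega, by omega, by rw [Set.uIcc_of_ge h]; constructor <;> omega⟩
      refine hQ (Function.update x i u) _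
        (ih u hu1 fun s hs' => hs s (Set.uIcc_subset_uIcc_left hu3 hs')) ?_
        (hs t Set.right_mem_uIcc)
      rw [dist1_update_update]
      exact hu2
  exact key _ t rfl h

/-! ### Connected components -/

lemma Comp.sites_subset {S : Set (Site d)} (C : Comp S) : C.sites ⊆ S := by
  rintro _ ⟨x, _, rfl⟩
  exact x.2

lemma Comp.sites_nonempty {S : Set (Site d)} (C : Comp S) : C.sites.Nonempty := by
  obtain ⟨x, hx⟩ := C.exists_rep
  exact ⟨x, x, hx, rfl⟩

lemma Comp.exists_mem_sites {S : Set (Site d)} {x : Site d} (hx : x ∈ S) :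
    ∃ C : Comp S, x ∈ C.sites :=
  ⟨((lattice d).induce S).connectedComponentMk ⟨x, hx⟩, ⟨x, hx⟩, rfl, rfl⟩

lemma Comp.eq_of_mem {S : Set (Site d)} {C C' : Comp S} {x : Site d} (h : x ∈ C.sites)
    (h' : x ∈ C'.sites) : C = C' := by
  obtain ⟨u, hu, rfl⟩ := h
  obtain ⟨v, hv, hvu⟩ := h'
  obtain rfl := Subtype.ext hvu
  exact hu.symm.trans hv

lemma Comp.mem_of_adj {S : Set (Site d)} (C : Comp S) {u v : Site d} (hu : u ∈ C.sites)
    (huv : dist1 u v = 1) (hv : v ∈ S) : v ∈ C.sites := by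
  obtain ⟨u, hu, rfl⟩ := hu
  refine ⟨⟨v, hv⟩, ?_, rfl⟩
  have : ((lattice d).induce S).Adj u ⟨v, hv⟩ := huv
  exact (SimpleGraph.ConnectedComponent.mem_supp_congr_adj C this).mp hu

lemma Comp.adjClosed {g : Set (Site d)} (C : Comp gᶜ) (u v : Site d) (hu : u ∈ C.sites)
    (huv : dist1 u v = 1) (hv : v ∉ g) : v ∈ C.sites :=
  C.mem_of_adj hu huv hv

/-- A function that does not change along the edges inside `S` is constant on components. -/
lemma Comp.eq_on_sites {β : Type*} {S : Set (Site d)} (C : Comp S) (f : Site d → β)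
    (hf : ∀ u v, u ∈ S → v ∈ S → dist1 u v = 1 → f u = f v) {x y : Site d}
    (hx : x ∈ C.sites) (hy : y ∈ C.sites) : f x = f y := by
  obtain ⟨x, hx, rfl⟩ := hx
  obtain ⟨y, hy, rfl⟩ := hy
  obtain ⟨p⟩ : ((lattice d).induce S).Reachable x y :=
    SimpleGraph.ConnectedComponent.exact (hx.trans hy.symm)
  clear hx hy
  induction p with
  | nil => rfl
  | cons h _ ih => exact (hf _ _ (Subtype.property _) (Subtype.property _) h).trans ih

/-- A function on the lattice that does not change along edges is constant. -/
lemma eq_of_forall_adj {β : Type*} (f : Site d → β)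
    (hf : ∀ u v, dist1 u v = 1 → f u = f v) (x y : Site d) : f x = f y := by
  by_contra h
  obtain ⟨z, hz, _⟩ := exists_mem_geodesic (g := ∅) (Q := {z | f z = f x})
    (fun u v hu huv _ => (hf u v huv).symm.trans hu) (x := x) (y := y) rfl (Ne.symm h)
  exact hz

/-! ### The unbounded component -/

lemma exists_box_bound (g : Set (Site d)) (hg : g.Finite) :
    ∃ N : ℤ, 0 ≤ N ∧ ∀ x ∈ g, ∀ i, |x i| ≤ N := by
  lift g to Finset (Site d) using hg
  refine ⟨∑ x ∈ g, ∑ i, |x i|, by positivity, fun x hx i => ?_⟩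
  calc |x i| ≤ ∑ i, |x i| := Finset.single_le_sum (f := fun i => |x i|)
        (fun _ _ => abs_nonneg _) (Finset.mem_univ i)
    _ ≤ _ := Finset.single_le_sum (f := fun x : Site d => ∑ i, |x i|)
        (fun _ _ => by positivity) hx

lemma exists_large_coord {C : Set (Site d)} (hC : C.Infinite) (N : ℤ) :
    ∃ x ∈ C, ∃ i, N < |x i| := by
  by_contra! h
  refine hC ((Set.finite_Icc (fun _ => -N : Site d) (fun _ => N)).subset fun x hx => ?_)
  exact ⟨fun i => (abs_le.mp (h x hx i)).1, fun i => (abs_le.mp (h x hx i)).2⟩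

/-- Coordinate `i` alone keeps the path outside the cube containing `g` while all others are moved
to `N + 1`; then any second coordinate does so while `i` itself moves. This is where `d ≥ 2` makes
the outside of a cube connected. -/
lemma corner_mem_of_large_coord (hd : 2 ≤ d) {g Q : Set (Site d)}
    (hQ : ∀ u v, u ∈ Q → dist1 u v = 1 → v ∉ g → v ∈ Q) {N : ℤ} (hN : 0 ≤ N)
    (hg : ∀ x ∈ g, ∀ i, |x i| ≤ N) {x : Site d} (hx : x ∈ Q) {i : Fin d} (hi : N < |x i|) :
    (fun _ => N + 1 : Site d) ∈ Q := by
  have hout : ∀ (y : Site d) (j : Fin d), N < |y j| → y ∉ g := fun y j hj hy =>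
    absurd (hg y hy j) (not_le.mpr hj)
  have key : ∀ s : Finset (Fin d), i ∉ s → (fun j => if j ∈ s then N + 1 else x j) ∈ Q := by
    intro s
    induction s using Finset.induction_on with
    | empty => intro _; simpa using hx
    | insert j s hj ih =>
      intro his
      have his' : i ≠ j ∧ i ∉ s := by simpa using his
      have h := update_mem_of_segment hQ (ih his'.2) j (N + 1) fun t _ => hout _ i (by
        rw [Function.update_of_ne his'.1, if_neg his'.2]; exact hi)
      convert h using 1
      funext k
      by_cases hk : k = j
      · subst hk; simp
      · simp [hk]
  obtain ⟨j, hj⟩ : ∃ j : Fin d, j ≠ i := by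
    have : Nontrivial (Fin d) := Fin.nontrivial_iff_two_le.mpr hd
    exact exists_ne i
  have h := update_mem_of_segment hQ (key (Finset.univ.erase i) (by simp)) i (N + 1)
    fun t _ => hout _ j (by
      rw [Function.update_of_ne hj, if_pos (by simp [hj]), abs_of_nonneg (by omega)]; omega)
  convert h using 1
  funext k
  by_cases hk : k = i
  · subst hk; simp
  · simp [hk]

/-- The complement of a finite set has at most one unbounded component. -/
lemma Comp.eq_of_infinite (hd : 2 ≤ d) {g : Set (Site d)} (hg : g.Finite) {C C' : Comp gᶜ}
    (hC : C.sites.Infinite) (hC' : C'.sites.Infinite) : C = C' := by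
  obtain ⟨N, hN, hgN⟩ := exists_box_bound g hg
  obtain ⟨x, hx, i, hi⟩ := exists_large_coord hC N
  obtain ⟨x', hx', j, hj⟩ := exists_large_coord hC' N
  exact Comp.eq_of_mem (corner_mem_of_large_coord hd C.adjClosed hN hgN hx hi)
    (corner_mem_of_large_coord hd C'.adjClosed hN hgN hx' hj)

/-- The complement of a finite set has an unbounded component. -/
lemma Comp.exists_infinite (hd : 2 ≤ d) {g : Set (Site d)} (hg : g.Finite) :
    ∃ C : Comp gᶜ, C.sites.Infinite := by
  obtain ⟨N, hN, hgN⟩ := exists_box_bound g hg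
  let i : Fin d := ⟨0, by omega⟩
  have hout : ∀ n : ℕ, (fun _ => N + 1 + n : Site d) ∈ gᶜ := fun n h => by
    have := hgN _ h i
    rw [abs_of_nonneg (by omega)] at this
    omega
  obtain ⟨C, hC⟩ := Comp.exists_mem_sites (hout 0)
  refine ⟨C, Set.infinite_of_injective_forall_mem (f := fun n : ℕ => (fun _ => N + 1 + n : Site d))
    (fun a b hab => by have := congrFun hab i; simpa using this) fun n => ?_⟩
  obtain ⟨Cn, hCn⟩ := Comp.exists_mem_sites (hout n)
  have h0 := corner_mem_of_large_coord hd C.adjClosed hN hgN hC (i := i) (by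
    rw [abs_of_nonneg (by push_cast; omega)]; push_cast; omega)
  have h1 := corner_mem_of_large_coord hd Cn.adjClosed hN hgN hCn (i := i) (by
    rw [abs_of_nonneg (by omega)]; omega)
  rw [Comp.eq_of_mem h0 h1]
  exact hCn

/-! ### Inner boundaries of volumes -/

lemma mem_of_mem_innerBoundary_vol {g : Set (Site d)} {x y : Site d} (hx : x ∈ vol g)
    (hy : y ∉ vol g) (hxy : dist1 x y = 1) :
    x ∈ g ∧ ∃ C : Comp gᶜ, C.sites.Infinite ∧ y ∈ C.sites := by
  have hy' : ∃ C : Comp gᶜ, C.sites.Infinite ∧ y ∈ C.sites := by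
    simpa [vol] using hy
  refine ⟨?_, hy'⟩
  by_contra hxg
  obtain ⟨C, hC, hyC⟩ := hy'
  refine hx ?_
  simp only [Set.mem_iUnion, Set.mem_ofPred_eq]
  exact ⟨C, hC, C.adjClosed y x hyC (by rw [dist1_comm]; exact hxy) hxg⟩

lemma innerBoundary_vol_nonempty (hd : 2 ≤ d) {g : Set (Site d)} (hg : g.Finite)
    (hne : g.Nonempty) : (innerBoundary (vol g)).Nonempty := by
  obtain ⟨C, hC⟩ := Comp.exists_infinite hd hg
  obtain ⟨y, hy⟩ := C.sites_nonempty
  obtain ⟨x, hx⟩ := hne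
  have hxv : x ∈ vol g := by
    intro h
    simp only [Set.mem_iUnion, Set.mem_ofPred_eq] at h
    obtain ⟨C, _, hxC⟩ := h
    exact C.sites_subset hxC hx
  have hyv : y ∉ vol g := fun h => h (by
    simp only [Set.mem_iUnion, Set.mem_ofPred_eq]
    exact ⟨C, hC, hy⟩)
  by_contra hemp
  rw [Set.not_nonempty_iff_eq_empty] at hemp
  obtain ⟨z, hz, _⟩ := exists_mem_geodesic (g := ∅) (Q := vol g) (fun u v hu huv _ => by
    by_contra hv
    have : u ∈ innerBoundary (vol g) := ⟨hu, v, hv, huv⟩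
    rw [hemp] at this
    exact this) hxv hyv
  exact hz

/-! ### Bounded components stay close to their boundary -/

lemma dist1_le_diam {F : Finset (Site d)} {x y : Site d} (hx : x ∈ F) (hy : y ∈ F) :
    dist1 x y ≤ diam F :=
  le_max_of_le_right (Finset.le_sup (f := fun p : Site d × Site d => dist1 p.1 p.2)
    (b := (x, y)) (Finset.mem_product.mpr ⟨hx, hy⟩))

lemma card_image_coord_le (F : Finset (Site d)) (i : Fin d) {m : ℕ} (hF : diam F ≤ m) :
    (F.image fun z => z i).card ≤ m + 1 := by
  rcases F.eq_empty_or_nonempty with rfl | hne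
  · simp
  obtain ⟨z₀, hz₀, hmin⟩ : ∃ z₀ ∈ F, ∀ z ∈ F, z₀ i ≤ z i := F.exists_min_image (fun z => z i) hne
  have hsub : (F.image fun z => z i) ⊆ Finset.Icc (z₀ i) (z₀ i + m) := by
    intro t ht
    obtain ⟨z, hz, rfl⟩ := Finset.mem_image.mp ht
    have h1 := natAbs_sub_le_dist1 z z₀ i
    have h2 := dist1_le_diam hz hz₀
    have := hmin z hz
    rw [Finset.mem_Icc]
    omega
  refine (Finset.card_le_card hsub).trans ?_
  rw [Int.card_Icc]
  omega

/-- A point in a bounded component of the complement of a union of `n` sets of diameter at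
most `m` is close to this union. -/
lemma exists_dist1_le_of_finite_comp (hd : 2 ≤ d) {g : Finset (Site d)}
    {fam : Finset (Finset (Site d))} (hfam : fam.sup id = g) {n m : ℕ} (hn : fam.card ≤ n)
    (hm : maxDiam fam ≤ m) (C : Comp (g : Set (Site d))ᶜ) (hC : C.sites.Finite) {y : Site d}
    (hy : y ∈ C.sites) : ∃ z ∈ g, dist1 y z ≤ n * (m + 1) := by
  by_contra! hfar
  let i : Fin d := ⟨0, by omega⟩
  let j : Fin d := ⟨1, by omega⟩
  have hij : i ≠ j := by simp [i, j]
  -- No point of `g` is near `y`, so `y` can move in direction `j` up to height `t`. A hyperplane at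
  -- height `t` free of `g` would then give an escape to infinity in direction `i`.
  have hseg : ∀ t ∈ Finset.Icc (y j) (y j + (n * (m + 1) : ℕ)),
      ∃ z ∈ g, z j = t := by
    intro t ht
    rw [Finset.mem_Icc] at ht
    have hmem : Function.update y j t ∈ C.sites := by
      refine update_mem_of_segment C.adjClosed hy j t fun s hs hsg => ?_
      rw [Set.uIcc_of_le ht.1] at hs
      have h1 := hfar _ hsg
      rw [dist1_update_self] at h1
      have := hs.1
      have := hs.2
      omega
    by_contra! hno
    refine Set.infinite_of_injective_forall_mem
      (f := fun k : ℕ => Function.update (Function.update y j t) i (k : ℤ)) ?_ ?_ hC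
    · intro a b hab
      have := congrFun hab i
      simpa using this
    · intro k
      refine update_mem_of_segment C.adjClosed hmem i k fun s _ hsg => hno _ hsg ?_
      rw [Function.update_of_ne hij.symm, Function.update_self]
  -- This needs `n * (m + 1) + 1` heights, but each of the at most `n` pieces covers at most `m +
  -- 1`.
  have hsub : Finset.Icc (y j) (y j + (n * (m + 1) : ℕ)) ⊆
      fam.biUnion fun F => F.image fun z => z j := by
    intro t ht
    obtain ⟨z, hz, rfl⟩ := hseg t ht
    rw [← hfam, Finset.mem_sup] at hz
    obtain ⟨F, hF, hzF⟩ := hz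
    exact Finset.mem_biUnion.mpr ⟨F, hF, Finset.mem_image_of_mem _ hzF⟩
  have h1 := Finset.card_le_card hsub
  have h2 : (fam.biUnion fun F => F.image fun z => z j).card ≤ fam.card * (m + 1) :=
    Finset.card_biUnion_le_card_mul _ _ _ fun F hF =>
      card_image_coord_le F j ((Finset.le_sup (f := diam) hF).trans hm)
  have h3 : fam.card * (m + 1) ≤ n * (m + 1) := Nat.mul_le_mul_right _ hn
  rw [Int.card_Icc] at h1
  omega

/-! ### Closed edge functions are gradients -/

/-- The neighbour of `x` in the positive `i`-th direction. -/
def shift (i : Fin d) (x : Site d) : Site d := Function.update x i (x i + 1)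

lemma shift_comm (i j : Fin d) (x : Site d) : shift i (shift j x) = shift j (shift i x) := by
  rcases eq_or_ne i j with rfl | h
  · rfl
  · unfold shift
    rw [Function.update_of_ne h, Function.update_of_ne h.symm, Function.update_comm h]

lemma dist1_shift (i : Fin d) (x : Site d) : dist1 x (shift i x) = 1 := by
  unfold shift
  rw [dist1_update_self]
  simp

lemma exists_shift_of_adj {u v : Site d} (h : dist1 u v = 1) :
    ∃ i, v = shift i u ∨ u = shift i v := by
  have huv : u ≠ v := fun e => by rw [e, dist1_self] at h; omega
  obtain ⟨i, hi⟩ := Function.ne_iff.mp huv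
  have h1 := natAbs_sub_le_dist1 u v i
  have h2 := dist1_update u v i (v i)
  have h3 : Function.update u i (v i) = v := by
    by_contra hne
    have := dist1_pos hne
    omega
  refine ⟨i, ?_⟩
  unfold shift
  rcases lt_or_gt_of_ne hi with hlt | hlt
  · left
    rw [← (show v i = u i + 1 by omega), h3]
  · right
    rw [← (show u i = v i + 1 by omega), ← h3, Function.update_idem, Function.update_eq_self]

/-- A primitive of a function on `ℤ` with values in `ℤˣ`. -/
def unitPrimitive (w : ℤ → ℤˣ) (n : ℤ) : ℤˣ :=
  (∏ i ∈ Finset.range n.toNat, w i) * ∏ i ∈ Finset.range (-n).toNat, w (-(i : ℤ) - 1)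

lemma unitPrimitive_add_one (w : ℤ → ℤˣ) (n : ℤ) :
    unitPrimitive w (n + 1) = unitPrimitive w n * w n := by
  unfold unitPrimitive
  rcases le_or_gt 0 n with hn | hn
  · obtain ⟨k, rfl⟩ := Int.eq_ofNat_of_zero_le hn
    have h1 : ((k : ℤ) + 1).toNat = k + 1 := by omega
    have h2 : (-((k : ℤ) + 1)).toNat = 0 := by omega
    have h3 : (-(k : ℤ)).toNat = 0 := by omega
    rw [h1, h2, h3, Int.toNat_natCast, Finset.prod_range_succ]
    simp
  · obtain ⟨k, rfl⟩ : ∃ k : ℕ, n = -(k : ℤ) - 1 := ⟨(-n - 1).toNat, by omega⟩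
    have h1 : (-(k : ℤ) - 1 + 1).toNat = 0 := by omega
    have h2 : (-(k : ℤ) - 1).toNat = 0 := by omega
    have h3 : (-(-(k : ℤ) - 1 + 1)).toNat = k := by omega
    have h4 : (-(-(k : ℤ) - 1)).toNat = k + 1 := by omega
    rw [h1, h2, h3, h4, Finset.prod_range_succ, Finset.prod_range_zero, one_mul, one_mul,
      mul_assoc, Int.units_mul_self, mul_one]

/-- Discrete Poincaré lemma with values in `{1, -1}`, by induction on the set of directions already
integrated. -/
lemma exists_gradient_of_closed (ω : Fin d → Site d → ℤˣ)
    (hω : ∀ i j x, ω i x * ω j (shift i x) = ω j x * ω i (shift j x)) (s : Finset (Fin d)) :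
    ∃ f : Site d → ℤˣ, ∀ i ∈ s, ∀ x, f (shift i x) = f x * ω i x := by
  induction s using Finset.induction_on with
  | empty => exact ⟨fun _ => 1, by simp⟩
  | insert k s hk ih =>
    obtain ⟨f, hf⟩ := ih
    -- The defect of `f` in the new direction `k`. Closedness makes it invariant under the shifts in
    -- `s`, so integrating it along `k` does not disturb the old directions.
    let ω' : Site d → ℤˣ := fun x => ω k x * f x * f (shift k x)
    have hω' : ∀ j ∈ s, ∀ x, ω' (shift j x) = ω' x := by
      intro j hj x
      simp only [ω']
      rw [shift_comm k j, hf j hj, hf j hj]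
      have h := hω k j x
      have e : ω k (shift j x) = ω j x * ω k x * ω j (shift k x) := by
        rw [mul_assoc, h, ← mul_assoc, Int.units_mul_self, one_mul]
      rw [e]
      rcases Int.units_eq_one_or (ω j x) with h1 | h1 <;>
        rcases Int.units_eq_one_or (ω j (shift k x)) with h2 | h2 <;> simp [h1, h2]
    let h : Site d → ℤˣ := fun x => unitPrimitive (fun t => ω' (Function.update x k t)) (x k)
    have hk1 : ∀ x, h (shift k x) = h x * ω' x := by
      intro x
      simp only [h, shift, Function.update_self, Function.update_idem]
      rw [unitPrimitive_add_one, Function.update_eq_self]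
    have hk2 : ∀ j ∈ s, ∀ x, h (shift j x) = h x := by
      intro j hj x
      have hjk : j ≠ k := fun e => hk (e ▸ hj)
      have e1 : ∀ t, Function.update (shift j x) k t = shift j (Function.update x k t) := by
        intro t
        unfold shift
        rw [Function.update_of_ne hjk, Function.update_comm hjk.symm]
      have e2 : shift j x k = x k := Function.update_of_ne hjk.symm _ _
      simp only [h, e1, e2, hω' j hj]
    refine ⟨fun x => f x * h x, fun i hi x => ?_⟩
    rcases Finset.mem_insert.mp hi with rfl | hi
    · simp only [hk1, ω']
      rcases Int.units_eq_one_or (f (shift i x)) with h1 | h1 <;>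
        rcases Int.units_eq_one_or (f x) with h2 | h2 <;> simp [h1, h2]
    · simp only [hk2 i hi, hf i hi, mul_right_comm]

/-- The sign changes of `σ` along the edges inside `g`. -/
def signChange (σ : Config d) (g : Finset (Site d)) (u v : Site d) : ℤˣ :=
  if u ∈ g ∧ v ∈ g then σ u * σ v else 1

lemma mem_boundary_of_ne {σ : Config d} {u v : Site d} (huv : dist1 u v ≤ 1) (h : σ u ≠ σ v) :
    u ∈ boundary σ :=
  ⟨fun hc => h ((hc u (by simp [dist1_self])).trans (hc v huv).symm),
    fun hc => h ((hc u (by simp [dist1_self])).trans (hc v huv).symm)⟩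

lemma signChange_of_near {σ : Config d} {g : Finset (Site d)}
    (hg : ∀ x ∈ g, ∀ y ∈ boundary σ, dist1 x y ≤ 2 → y ∈ g) {w u v : Site d} (hw : w ∈ g)
    (hwu : dist1 w u ≤ 2) (hwv : dist1 w v ≤ 2) (huv : dist1 u v = 1) :
    signChange σ g u v = σ u * σ v := by
  unfold signChange
  split_ifs with h
  · rfl
  · by_cases hs : σ u = σ v
    · rw [hs, Int.units_mul_self]
    · refine absurd ⟨hg w hw u (mem_boundary_of_ne huv.le hs) hwu,
        hg w hw v (mem_boundary_of_ne (by rw [dist1_comm]; exact huv.le) (Ne.symm hs)) hwv⟩ h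

lemma signChange_of_not_mem {σ : Config d} {g : Finset (Site d)} {u v : Site d}
    (h : u ∉ g ∨ v ∉ g) : signChange σ g u v = 1 :=
  if_neg fun h' => h.elim (fun h => h h'.1) fun h => h h'.2

lemma signChange_comm (σ : Config d) (g : Finset (Site d)) (u v : Site d) :
    signChange σ g u v = signChange σ g v u := by
  unfold signChange
  simp only [and_comm, mul_comm]

/-- Near `g` the edge function agrees with the gradient of `σ`, and away from `g` it is trivial;
since a plaquette has diameter 2, each plaquette sees only one of the two regimes. -/
lemma exists_gradient_signChange {σ : Config d} {g : Finset (Site d)}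
    (hg : ∀ x ∈ g, ∀ y ∈ boundary σ, dist1 x y ≤ 2 → y ∈ g) :
    ∃ f : Site d → ℤˣ, ∀ u v, dist1 u v = 1 → f u * f v = signChange σ g u v := by
  obtain ⟨f, hf⟩ := exists_gradient_of_closed (fun i x => signChange σ g x (shift i x))
    (fun i j x => by
      set a := shift i x with ha
      set b := shift j x with hb
      set c := shift j a with hc
      have hc' : shift i b = c := by rw [hb, hc, ha, shift_comm]
      rw [hc']
      have xa : dist1 x a = 1 := dist1_shift i x
      have xb : dist1 x b = 1 := dist1_shift j x
      have ac : dist1 a c = 1 := dist1_shift j a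
      have bc : dist1 b c = 1 := hc' ▸ dist1_shift i b
      have ax := dist1_comm a x
      have bx := dist1_comm b x
      have ca := dist1_comm c a
      have cb := dist1_comm c b
      have xx := dist1_self x
      have aa := dist1_self a
      have bb := dist1_self b
      have cc := dist1_self c
      have xc := dist1_triangle x a c
      have cx := dist1_comm c x
      have ab := dist1_triangle a x b
      have ba := dist1_comm b a
      -- Without such a `w` the opposite corners `x` and `c` are outside `g`; every edge of the
      -- plaquette has one of them as an endpoint.
      by_cases hw : ∃ w ∈ g, dist1 w x ≤ 2 ∧ dist1 w a ≤ 2 ∧ dist1 w b ≤ 2 ∧ dist1 w c ≤ 2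
      · obtain ⟨w, hw, hx, ha, hb, hc⟩ := hw
        rw [signChange_of_near hg hw hx ha xa, signChange_of_near hg hw ha hc ac,
          signChange_of_near hg hw hx hb xb, signChange_of_near hg hw hb hc bc]
        rcases Int.units_eq_one_or (σ a) with h1 | h1 <;>
          rcases Int.units_eq_one_or (σ b) with h2 | h2 <;> simp [h1, h2]
      · push Not at hw
        have hx : x ∉ g := fun h => by
          have := hw x h (by omega) (by omega) (by omega)
          omega
        have hc : c ∉ g := fun h => by
          have := hw c h (by omega) (by omega) (by omega)
          omega
        rw [signChange_of_not_mem (.inl hx), signChange_of_not_mem (.inr hc),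
          signChange_of_not_mem (.inl hx), signChange_of_not_mem (.inr hc)])
    Finset.univ
  refine ⟨f, fun u v huv => ?_⟩
  obtain ⟨i, rfl | rfl⟩ := exists_shift_of_adj huv
  · rw [hf i (Finset.mem_univ i), ← mul_assoc, Int.units_mul_self, one_mul]
  · rw [hf i (Finset.mem_univ i), mul_right_comm, Int.units_mul_self, one_mul, signChange_comm]

/-! ### Separation of the parts of a partition -/

lemma one_le_maxDiam {F : Finset (Finset (Site d))} (hF : F.Nonempty) : 1 ≤ maxDiam F := by
  obtain ⟨A, hA⟩ := hF
  exact (le_max_left _ _).trans (Finset.le_sup (f := diam) hA)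

lemma IsMARPartition.lt_dist1 {M a r : ℝ} {σ : Config d} {P : Finset (Finset (Site d))}
    (hP : IsMARPartition M a r σ P) (hM : 0 ≤ M) (ha : 0 ≤ a) {g g' : Finset (Site d)}
    (hg : g ∈ P) (hg' : g' ∈ P) (hne : g ≠ g') {x y : Site d} (hx : x ∈ g) (hy : y ∈ g') :
    M < dist1 x y := by
  obtain ⟨fam, h1, h2⟩ := hP.separated
  refine lt_of_le_of_lt ?_ (h2 g hg g' hg' hne x hx y hy)
  refine le_mul_of_one_le_right hM (Real.one_le_rpow ?_ ha)
  have e1 : (1 : ℝ) ≤ (maxDiam (fam g) : ℝ) := by exact_mod_cast one_le_maxDiam (h1 g hg).1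
  have e2 : (1 : ℝ) ≤ (maxDiam (fam g') : ℝ) := by exact_mod_cast one_le_maxDiam (h1 g' hg').1
  exact le_min e1 e2

lemma IsMARPartition.mem_part_of_near {M a r : ℝ} {σ : Config d} {P : Finset (Finset (Site d))}
    (hP : IsMARPartition M a r σ P) (hM : 2 ≤ M) (ha : 0 ≤ a) {g : Finset (Site d)} (hg : g ∈ P)
    {x y : Site d} (hx : x ∈ g) (hy : y ∈ boundary σ) (hxy : dist1 x y ≤ 2) : y ∈ g := by
  rw [← hP.cover] at hy
  simp only [Set.mem_iUnion, Finset.mem_coe] at hy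
  obtain ⟨g', hg', hyg'⟩ := hy
  rcases eq_or_ne g g' with rfl | hne
  · exact hyg'
  · have h1 := hP.lt_dist1 (by linarith) ha hg hg' hne hx hyg'
    have h2 : (dist1 x y : ℝ) ≤ 2 := by exact_mod_cast hxy
    linarith

lemma IsMARPartition.subset_boundary {M a r : ℝ} {σ : Config d} {P : Finset (Finset (Site d))}
    (hP : IsMARPartition M a r σ P) {g : Finset (Site d)} (hg : g ∈ P) {x : Site d} (hx : x ∈ g) :
    x ∈ boundary σ := by
  rw [← hP.cover]
  simp only [Set.mem_iUnion, Finset.mem_coe]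
  exact ⟨g, hg, hx⟩

/-- If the sign at a point `y` of a component of the complement of the part `g` differs from the
sign at a point of this component next to `g`, then a single other part separates `y` from `g`. -/
lemma IsMARPartition.exists_separating_part {M a r : ℝ} {σ : Config d}
    {P : Finset (Finset (Site d))} (hP : IsMARPartition M a r σ P) (hM : 2 ≤ M) (ha : 0 ≤ a)
    {g : Finset (Site d)} (hg : g ∈ P) (C : Comp (g : Set (Site d))ᶜ) {x y : Site d}
    (hx : x ∈ C.sites) (hxg : ∃ w ∈ g, dist1 w x = 1) (hy : y ∈ C.sites) (hxy : σ x ≠ σ y) :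
    ∃ g' ∈ P, g ≠ g' ∧ ∃ K : Comp (g' : Set (Site d))ᶜ,
      (g : Set (Site d)) ⊆ K.sites ∧ y ∉ K.sites := by
  have hgrad : ∀ g' : Finset (Site d), ∃ f : Site d → ℤˣ, g' ∈ P →
      ∀ u v, dist1 u v = 1 → f u * f v = signChange σ g' u v := by
    intro g'
    by_cases h : g' ∈ P
    · obtain ⟨f, hf⟩ := exists_gradient_signChange (g := g') fun u hu v hv huv =>
        hP.mem_part_of_near hM ha h hu hv huv
      exact ⟨f, fun _ => hf⟩
    · exact ⟨fun _ => 1, fun h' => absurd h' h⟩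
  choose f hf using hgrad
  have hconst : ∀ g' ∈ P, ∀ K : Comp (g' : Set (Site d))ᶜ, ∀ u ∈ K.sites, ∀ v ∈ K.sites,
      f g' u = f g' v := by
    intro g' hg' K u hu v hv
    refine K.eq_on_sites (f g') (fun u v hu _ huv => ?_) hu hv
    have := hf g' hg' u v huv
    rw [signChange_of_not_mem (.inl (by simpa using hu))] at this
    rcases Int.units_eq_one_or (f g' u) with h1 | h1 <;>
      rcases Int.units_eq_one_or (f g' v) with h2 | h2 <;> simp [h1, h2] at this ⊢
  -- Both endpoints of a sign-changing edge are boundary points at distance 1, hence in the same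
  -- part, and exactly one factor records the change. So `σ` times the product of the primitives is
  -- constant.
  have hprod : ∀ u v, dist1 u v = 1 → σ u * ∏ g' ∈ P, f g' u = σ v * ∏ g' ∈ P, f g' v := by
    intro u v huv
    have h1 : ∏ g' ∈ P, (f g' u * f g' v) = σ u * σ v := by
      rw [Finset.prod_congr rfl fun g' hg' => hf g' hg' u v huv]
      by_cases hs : σ u = σ v
      · rw [hs, Int.units_mul_self]
        refine Finset.prod_eq_one fun g' _ => ?_
        unfold signChange
        rw [hs, Int.units_mul_self, ite_self]
      · have hu := mem_boundary_of_ne huv.le hs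
        have hv := mem_boundary_of_ne (v := u) (by rw [dist1_comm]; exact huv.le) (Ne.symm hs)
        have hu' := hu
        rw [← hP.cover] at hu'
        simp only [Set.mem_iUnion, Finset.mem_coe] at hu'
        obtain ⟨g₀, hg₀, hug₀⟩ := hu'
        have hvg₀ := hP.mem_part_of_near hM ha hg₀ hug₀ hv (by omega)
        rw [Finset.prod_eq_single_of_mem g₀ hg₀]
        · unfold signChange
          rw [if_pos ⟨hug₀, hvg₀⟩]
        · intro g' hg' hne
          refine signChange_of_not_mem (.inl fun hug' => ?_)
          exact Finset.disjoint_left.mp (hP.disjoint g' hg' g₀ hg₀ hne) hug' hug₀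
    rw [Finset.prod_mul_distrib] at h1
    rcases Int.units_eq_one_or (∏ g' ∈ P, f g' u) with e1 | e1 <;>
      rcases Int.units_eq_one_or (∏ g' ∈ P, f g' v) with e2 | e2 <;>
      rcases Int.units_eq_one_or (σ u) with e3 | e3 <;>
      rcases Int.units_eq_one_or (σ v) with e4 | e4 <;> simp [e1, e2, e3, e4] at h1 ⊢
  have hall := eq_of_forall_adj _ hprod x y
  obtain ⟨g', hg', hne⟩ : ∃ g' ∈ P, f g' x ≠ f g' y := by
    by_contra! h
    rw [Finset.prod_congr rfl h] at hall
    exact hxy (mul_right_cancel hall)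
  have hgg' : g ≠ g' := by
    rintro rfl
    exact hne (hconst g hg C x hx y hy)
  obtain ⟨K, hK⟩ := hP.oneComponent g' hg' g hg hgg'.symm
  -- Since `x` is adjacent to `g ⊆ K` and cannot lie in `g'`, it belongs to `K`; the primitive of
  -- `g'` is constant on `K` but distinguishes `x` from `y`.
  refine ⟨g', hg', hgg', K, hK, fun hyK => hne (hconst g' hg' K x ?_ y hyK)⟩
  obtain ⟨w, hw, hwx⟩ := hxg
  refine K.adjClosed w x (hK hw) hwx fun hxg' => ?_
  have := hP.lt_dist1 (by linarith) ha hg hg' hgg' hw hxg'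
  rw [hwx] at this
  norm_num at this
  linarith

/-- `signOn` defaults to -1 when `σ` is not identically 1, and even then the value is attained.
Constancy of `σ` on the inner boundary is thus never needed. -/
lemma exists_sign_eq_signOn (σ : Config d) {S : Set (Site d)} (hS : S.Nonempty) :
    ∃ x ∈ S, σ x = signOn σ S := by
  unfold signOn
  split_ifs with h
  · obtain ⟨x, hx⟩ := hS
    exact ⟨x, hx, h x hx⟩
  · push Not at h
    obtain ⟨x, hx, hne⟩ := h
    exact ⟨x, hx, (Int.units_eq_one_or _).resolve_left hne⟩

/-- The label of a component of the complement of a part is attained next to the part. -/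
lemma IsMARPartition.exists_sign_eq_label (hd : 2 ≤ d) {M a r : ℝ} {σ : Config d}
    {P : Finset (Finset (Site d))} (hP : IsMARPartition M a r σ P) (hM : 2 ≤ M) (ha : 0 ≤ a)
    {g : Finset (Site d)} (hg : g ∈ P) (C : Comp (g : Set (Site d))ᶜ) :
    ∃ x ∈ C.sites, (∃ w ∈ g, dist1 w x = 1) ∧ σ x = labelOf σ g C := by
  unfold labelOf
  split_ifs with hC
  · obtain ⟨x, ⟨hxv, y, hyv, hxy⟩, hσ⟩ := exists_sign_eq_signOn σ
      (innerBoundary_vol_nonempty hd g.finite_toSet (hP.nonempty g hg))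
    -- The inner boundary of `V(g)` lies in `g`. The step out into the unbounded component keeps the
    -- sign, since otherwise the outer endpoint would be a boundary point near `g` and hence in `g`.
    obtain ⟨hxg, C', hC', hyC'⟩ := mem_of_mem_innerBoundary_vol hxv hyv hxy
    obtain rfl := Comp.eq_of_infinite hd g.finite_toSet hC hC'
    refine ⟨y, hyC', ⟨x, hxg, hxy⟩, ?_⟩
    rw [← hσ]
    by_contra hne
    have hyb : y ∈ boundary σ := mem_boundary_of_ne (by rw [dist1_comm]; exact hxy.le) hne
    exact C.sites_subset hyC' (hP.mem_part_of_near hM ha hg hxg hyb (by omega))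
  · obtain ⟨x, ⟨hxv, y, hyv, hxy⟩, hσ⟩ := exists_sign_eq_signOn σ
      (innerBoundary_vol_nonempty hd (Set.not_infinite.mp hC) C.sites_nonempty)
    -- The inner boundary of `V(C)` already lies in `C`, and a neighbour of it outside `C` must be
    -- in `g`.
    obtain ⟨hxC, C', _, hyC'⟩ := mem_of_mem_innerBoundary_vol hxv hyv hxy
    refine ⟨x, hxC, ⟨y, ?_, by rw [dist1_comm]; exact hxy⟩, hσ⟩
    by_contra hyg
    exact C'.sites_subset hyC' (C.adjClosed x y hxC hxy hyg)

/-- A point whose sign is not the label of its component is separated from the part by a single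
other part. -/
lemma IsMARPartition.exists_separating_part_of_ne_label (hd : 2 ≤ d) {M a r : ℝ} {σ : Config d}
    {P : Finset (Finset (Site d))} (hP : IsMARPartition M a r σ P) (hM : 2 ≤ M) (ha : 0 ≤ a)
    {g : Finset (Site d)} (hg : g ∈ P) (C : Comp (g : Set (Site d))ᶜ) {y : Site d}
    (hy : y ∈ C.sites) (h : σ y ≠ labelOf σ g C) :
    ∃ g' ∈ P, g ≠ g' ∧ ∃ K : Comp (g' : Set (Site d))ᶜ,
      (g : Set (Site d)) ⊆ K.sites ∧ y ∉ K.sites := by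
  obtain ⟨x, hx, hxg, hσ⟩ := hP.exists_sign_eq_label hd hM ha hg C
  exact hP.exists_separating_part hM ha hg C hx hxg hy (by rw [hσ]; exact Ne.symm h)

/-! ### Boxes -/

/-- The cube of side `2 k + 1` around `y`. -/
def box (y : Site d) (k : ℕ) : Finset (Site d) := Finset.Icc (fun i => y i - k) (fun i => y i + k)

lemma mem_box {y z : Site d} {k : ℕ} : z ∈ box y k ↔ ∀ i, (y i - z i).natAbs ≤ k := by
  unfold box
  rw [Finset.mem_Icc, Pi.le_def, Pi.le_def, ← forall_and]
  exact forall_congr' fun i => by omega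

lemma mem_box_comm {y z : Site d} {k : ℕ} : z ∈ box y k ↔ y ∈ box z k := by
  rw [mem_box, mem_box]
  exact forall_congr' fun i => by omega

lemma card_box (y : Site d) (k : ℕ) : (box y k).card = (2 * k + 1) ^ d := by
  unfold box
  rw [Pi.card_Icc, Finset.prod_congr rfl (g := fun _ => 2 * k + 1)]
  · simp
  · intro i _
    rw [Int.card_Icc]
    omega

lemma mem_box_of_dist1_le {y z : Site d} {k : ℕ} (h : dist1 y z ≤ k) : z ∈ box y k :=
  mem_box.mpr fun i => (natAbs_sub_le_dist1 y z i).trans h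

lemma dist1_le_of_mem_box {y z : Site d} {k : ℕ} (h : z ∈ box y k) : dist1 y z ≤ d * k := by
  refine (Finset.sum_le_sum fun i _ => mem_box.mp h i).trans ?_
  simp

/-- The number of points close to a union of `n` sets of diameter at most `m`. -/
lemma exists_finset_near {g : Finset (Site d)} {fam : Finset (Finset (Site d))}
    (hfam : fam.sup id = g) {n m : ℕ} (hn : fam.card ≤ n) (hm : maxDiam fam ≤ m) (l : ℕ) :
    ∃ U : Finset (Site d), U.card ≤ n * (2 * (m + l) + 1) ^ d ∧
      ∀ y, (∃ z ∈ g, dist1 y z ≤ l) → y ∈ U := by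
  refine ⟨fam.biUnion fun F => if h : F.Nonempty then box h.choose (m + l) else ∅, ?_, ?_⟩
  · refine (Finset.card_biUnion_le_card_mul _ _ ((2 * (m + l) + 1) ^ d) fun F _ => ?_).trans
      (Nat.mul_le_mul_right _ hn)
    split_ifs with h
    · rw [card_box]
    · simp
  · rintro y ⟨z, hz, hyz⟩
    rw [← hfam, Finset.mem_sup] at hz
    obtain ⟨F, hF, hzF⟩ := hz
    have hne : F.Nonempty := ⟨z, hzF⟩
    refine Finset.mem_biUnion.mpr ⟨F, hF, ?_⟩
    rw [dif_pos hne]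
    refine mem_box_of_dist1_le ?_
    have h1 := dist1_le_diam hne.choose_spec hzF
    have h2 : diam F ≤ maxDiam fam := Finset.le_sup (f := diam) hF
    have h3 := dist1_triangle hne.choose z y
    rw [dist1_comm z y] at h3
    omega

/-! ### The coupling constants -/

lemma coupling_nonneg {J α : ℝ} (hJ : 0 ≤ J) (x y : Site d) : 0 ≤ coupling J α x y := by
  unfold coupling
  split_ifs <;> positivity

lemma coupling_comm (J α : ℝ) (x y : Site d) : coupling J α x y = coupling J α y x := by
  unfold coupling
  rw [dist1_comm]
  simp only [eq_comm]

lemma coupling_eq {J α : ℝ} (hα : 0 < α) (x y : Site d) :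
    coupling J α x y = J * (dist1 x y : ℝ) ^ (-α) := by
  unfold coupling
  split_ifs with h
  · rw [h, dist1_self, Nat.cast_zero, Real.zero_rpow (by linarith), mul_zero]
  · rw [Real.rpow_neg (by positivity), div_eq_mul_inv]

lemma coupling_le_of_dist1_le {J α : ℝ} (hJ : 0 ≤ J) (hα : 0 ≤ α) {x y u v : Site d}
    (huv : u ≠ v) (h : dist1 u v ≤ 2 * dist1 x y) :
    coupling J α x y ≤ 2 ^ α * coupling J α u v := by
  rcases eq_or_ne x y with rfl | hxy
  · have : coupling J α x x = 0 := if_pos rfl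
    rw [this]
    exact mul_nonneg (by positivity) (coupling_nonneg hJ u v)
  · unfold coupling
    rw [if_neg hxy, if_neg huv]
    have h1 : (0 : ℝ) < dist1 x y := by exact_mod_cast dist1_pos hxy
    have h2 : (0 : ℝ) < dist1 u v := by exact_mod_cast dist1_pos huv
    have h3 : (dist1 u v : ℝ) ≤ 2 * dist1 x y := by exact_mod_cast h
    have h4 : (dist1 u v : ℝ) ^ α ≤ 2 ^ α * (dist1 x y : ℝ) ^ α := by
      rw [← Real.mul_rpow (by norm_num) h1.le]
      exact Real.rpow_le_rpow h2.le h3 hα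
    have h5 : (0 : ℝ) < (dist1 x y : ℝ) ^ α := by positivity
    have h6 : (0 : ℝ) < (dist1 u v : ℝ) ^ α := by positivity
    rw [← mul_div_assoc, div_le_div_iff₀ h5 h6]
    nlinarith

/-- Comparison with the norm sum over the lattice `ℤ^d` in `ℝ^d`: the sup norm is at most the
`ℓ¹`-norm. -/
lemma summable_dist1_zero_rpow {β : ℝ} (hβ : (d : ℝ) < β) :
    Summable fun y : Site d => (dist1 0 y : ℝ) ^ (-β) := by
  let b := Pi.basisFun ℝ (Fin d)
  let L := Submodule.span ℤ (Set.range b)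
  have hL : Summable fun z : L => ‖z‖ ^ (-β) := by
    refine ZLattice.summable_norm_rpow L (-β) ?_
    have : Module.finrank ℤ L = d := by
      rw [ZLattice.rank ℝ L]
      simp
    rw [this]
    linarith
  have hmem : ∀ y : Site d, (fun i => (y i : ℝ)) ∈ L := by
    intro y
    rw [b.mem_span_iff_repr_mem ℤ]
    intro i
    exact ⟨y i, by simp [b]⟩
  let φ : Site d → L := fun y => ⟨fun i => (y i : ℝ), hmem y⟩
  have hφ : Function.Injective φ := by
    intro y z h
    funext i
    have := congrFun (congrArg Subtype.val h) i
    simpa [φ] using this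
  refine Summable.of_nonneg_of_le (fun _ => by positivity) (fun y => ?_) (hL.comp_injective hφ)
  rcases eq_or_ne y 0 with rfl | hy
  · rw [dist1_self, Nat.cast_zero]
    rcases eq_or_ne β 0 with rfl | hβ
    · simp
    · rw [Real.zero_rpow (by simpa using hβ)]
      exact Real.rpow_nonneg (norm_nonneg _) _
  · have h0 : φ y ≠ 0 := by
      intro h
      refine hy (hφ (h.trans ?_))
      ext i
      simp [φ]
    have hle : ‖φ y‖ ≤ dist1 0 y := by
      change ‖fun i => (y i : ℝ)‖ ≤ _
      rw [pi_norm_le_iff_of_nonneg (by positivity)]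
      intro i
      have := natAbs_sub_le_dist1 0 y i
      rw [Real.norm_eq_abs, ← Int.cast_abs, Int.abs_eq_natAbs]
      have h2 : (y i).natAbs ≤ dist1 0 y := by simpa using this
      exact_mod_cast h2
    refine Real.rpow_le_rpow_of_nonpos (norm_pos_iff.mpr h0) hle ?_
    have : (0 : ℝ) ≤ d := by positivity
    linarith

lemma hasSum_dist1_rpow {β : ℝ} (hβ : (d : ℝ) < β) (x : Site d) :
    HasSum (fun y => (dist1 x y : ℝ) ^ (-β)) (∑' y : Site d, (dist1 0 y : ℝ) ^ (-β)) := by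
  have h := (summable_dist1_zero_rpow hβ).hasSum
  rw [← (Equiv.addLeft x).hasSum_iff]
  convert h using 1
  funext y
  have := dist1_add_left x 0 y
  rw [add_zero] at this
  simp [this]

lemma summable_coupling {J α : ℝ} (hα : (d : ℝ) < α) (x : Site d) :
    Summable fun y => coupling J α x y := by
  have h0 : 0 < α := lt_of_le_of_lt (by positivity) hα
  simp only [coupling_eq h0]
  exact (hasSum_dist1_rpow hα x).summable.mul_left J

/-! ### The interaction of a site with a set -/

/-- The total coupling between the site `x` and the set `T`. -/
def interaction (J α : ℝ) (x : Site d) (T : Set (Site d)) : ℝ :=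
  ∑' y, T.indicator (coupling J α x) y

lemma summable_interaction {J α : ℝ} (hα : (d : ℝ) < α) (x : Site d) (T : Set (Site d)) :
    Summable (T.indicator (coupling J α x)) :=
  (summable_coupling hα x).indicator T

lemma interaction_nonneg {J α : ℝ} (hJ : 0 ≤ J) (x : Site d) (T : Set (Site d)) :
    0 ≤ interaction J α x T :=
  tsum_nonneg fun _ => Set.indicator_nonneg (fun y _ => coupling_nonneg hJ x y) _

lemma interaction_mono {J α : ℝ} (hJ : 0 ≤ J) (hα : (d : ℝ) < α) (x : Site d)
    {S T : Set (Site d)} (h : S ⊆ T) : interaction J α x S ≤ interaction J α x T :=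
  (summable_interaction hα x S).tsum_le_tsum
    (fun y => Set.indicator_le_indicator_of_subset h (fun y => coupling_nonneg hJ x y) y)
    (summable_interaction hα x T)

lemma interaction_union_le {J α : ℝ} (hJ : 0 ≤ J) (hα : (d : ℝ) < α) (x : Site d)
    (S T : Set (Site d)) :
    interaction J α x (S ∪ T) ≤ interaction J α x S + interaction J α x T := by
  unfold interaction
  rw [← (summable_interaction hα x S).tsum_add (summable_interaction hα x T)]
  refine (summable_interaction hα x _).tsum_le_tsum (fun y => ?_)
    ((summable_interaction hα x S).add (summable_interaction hα x T))
  have := coupling_nonneg (α := α) hJ x y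
  by_cases hS : y ∈ S <;> by_cases hT : y ∈ T <;> simp [hS, hT, this]

lemma le_interaction_univ (hd : 0 < d) {J α : ℝ} (hJ : 0 ≤ J) (hα : (d : ℝ) < α) (x : Site d) :
    J ≤ interaction J α x Set.univ := by
  let y := shift ⟨0, hd⟩ x
  have hy : dist1 x y = 1 := dist1_shift _ x
  have h0 : 0 < α := lt_of_le_of_lt (by positivity) hα
  have h := (summable_interaction (J := J) hα x Set.univ).le_tsum y fun z _ =>
    Set.indicator_nonneg (fun y _ => coupling_nonneg hJ x y) z
  rw [Set.indicator_univ, coupling_eq h0, hy] at h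
  unfold interaction
  rw [Set.indicator_univ]
  simpa using h

/-- The decay is split between the exponent `β > d`, which makes the sum converge, and the rest `α -
β`, which is evaluated at the distance `R`. -/
lemma interaction_le_of_far {J α β : ℝ} (hJ : 0 ≤ J) (hβ : (d : ℝ) < β) (hβα : β ≤ α)
    {x : Site d} {T : Set (Site d)} {R : ℝ} (hR : 0 < R) (hT : ∀ y ∈ T, R ≤ dist1 x y) :
    interaction J α x T ≤
      J * (∑' y : Site d, (dist1 0 y : ℝ) ^ (-β)) * R ^ (-(α - β)) := by
  have hα : (d : ℝ) < α := hβ.trans_le hβα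
  have h0 : 0 < α := lt_of_le_of_lt (by positivity) hα
  have h := ((hasSum_dist1_rpow hβ x).mul_left J).mul_right (R ^ (-(α - β)))
  rw [← h.tsum_eq]
  refine (summable_interaction hα x T).tsum_le_tsum (fun y => ?_) h.summable
  by_cases hy : y ∈ T
  · rw [Set.indicator_of_mem hy, coupling_eq h0, mul_assoc]
    refine mul_le_mul_of_nonneg_left ?_ hJ
    have hpos : (0 : ℝ) < dist1 x y := hR.trans_le (hT y hy)
    have : (dist1 x y : ℝ) ^ (-α) = (dist1 x y : ℝ) ^ (-β) * (dist1 x y : ℝ) ^ (-(α - β)) := by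
      rw [← Real.rpow_add hpos]
      congr 1
      ring
    rw [this]
    refine mul_le_mul_of_nonneg_left ?_ (by positivity)
    exact Real.rpow_le_rpow_of_nonpos hR (hT y hy) (by linarith)
  · rw [Set.indicator_of_notMem hy]
    positivity

/-! ### Sparse sets have a small interaction -/

/-- Passing to `ENNReal` lets the double sums below be exchanged without summability conditions. -/
lemma ofReal_interaction {J α : ℝ} (hJ : 0 ≤ J) (hα : (d : ℝ) < α) (x : Site d)
    (T : Set (Site d)) :
    ENNReal.ofReal (interaction J α x T) =
      ∑' y, T.indicator (fun y => ENNReal.ofReal (coupling J α x y)) y := by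
  unfold interaction
  rw [ENNReal.ofReal_tsum_of_nonneg
    (fun y => Set.indicator_nonneg (fun y _ => coupling_nonneg hJ x y) y)
    (summable_interaction hα x T)]
  refine tsum_congr fun y => ?_
  by_cases hy : y ∈ T <;> simp [hy]

/-- If around every point of `T` there is a large box in `S` whose interaction with `x` is
comparable, and these boxes overlap rarely, then the interaction with `T` is much smaller than the
interaction with `S`. -/
lemma tsum_indicator_le_of_sparse (c : Site d → ENNReal) (l : ENNReal) {S T : Set (Site d)}
    {k : ℕ} {q : ENNReal} (hbox : ∀ y ∈ T, ∀ z ∈ box y k, z ∈ S ∧ c y ≤ l * c z)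
    (hcount : ∀ z, ∑' y, (T.indicator (fun y => if z ∈ box y k then (1 : ENNReal) else 0) y)
      ≤ q * ((2 * k + 1 : ℕ) : ENNReal) ^ d) :
    ∑' y, T.indicator c y ≤ l * q * ∑' z, S.indicator c z := by
  set b : ENNReal := ((2 * k + 1 : ℕ) : ENNReal) ^ d with hb
  have hb0 : b ≠ 0 := pow_ne_zero _ (by simp)
  have hbt : b ≠ ⊤ := ENNReal.pow_ne_top (ENNReal.natCast_ne_top _)
  -- Double counting: `b` is the number of sites in a box, so `c y * b` spreads `c y` over the box
  -- of `y`; after exchanging the sums each `z` is charged once for every box containing it.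
  have h1 : ∀ y, T.indicator c y * b ≤ ∑' z,
      T.indicator (fun y => if z ∈ box y k then (1 : ENNReal) else 0) y
        * (l * S.indicator c z) := by
    intro y
    by_cases hy : y ∈ T
    · simp only [Set.indicator_of_mem hy]
      calc c y * b = ∑ z ∈ box y k, c y := by
            rw [Finset.sum_const, card_box, nsmul_eq_mul, hb, mul_comm]
            push_cast
            rfl
        _ ≤ ∑ z ∈ box y k, (if z ∈ box y k then (1 : ENNReal) else 0) * (l * S.indicator c z) := by
            refine Finset.sum_le_sum fun z hz => ?_
            rw [if_pos hz, one_mul, Set.indicator_of_mem (hbox y hy z hz).1]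
            exact (hbox y hy z hz).2
        _ ≤ _ := ENNReal.sum_le_tsum _
    · simp [Set.indicator_of_notMem hy]
  have h2 : (∑' y, T.indicator c y) * b ≤ (l * q * ∑' z, S.indicator c z) * b := by
    rw [← ENNReal.tsum_mul_right]
    calc ∑' y, T.indicator c y * b ≤ ∑' y, ∑' z,
          T.indicator (fun y => if z ∈ box y k then (1 : ENNReal) else 0) y
            * (l * S.indicator c z) := ENNReal.tsum_le_tsum h1
      _ = ∑' z, ∑' y, T.indicator (fun y => if z ∈ box y k then (1 : ENNReal) else 0) y
            * (l * S.indicator c z) := ENNReal.tsum_comm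
      _ ≤ ∑' z, (q * b) * (l * S.indicator c z) := by
          refine ENNReal.tsum_le_tsum fun z => ?_
          rw [ENNReal.tsum_mul_right]
          exact mul_le_mul_left (hcount z) _
      _ = _ := by
          rw [ENNReal.tsum_mul_left, ENNReal.tsum_mul_left]
          ring
  exact (ENNReal.mul_le_mul_iff_left hb0 hbt).mp h2

/-- Sums the sparse estimate over the scales `m`; `q m` bounds the density of `T m` at box radius `k
m`. -/
lemma interaction_iUnion_le_of_sparse {J α : ℝ} (hJ : 0 ≤ J) (hα : (d : ℝ) < α) (x : Site d)
    {S : Set (Site d)} {T : ℕ → Set (Site d)} {k N : ℕ → ℕ} {q : ℕ → ℝ} {Q : ℝ}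
    (hbox : ∀ m, ∀ y ∈ T m, ∀ z ∈ box y (k m), z ∈ S ∧ x ≠ z ∧ dist1 x z ≤ 2 * dist1 x y)
    (hcount : ∀ m z, ∃ U : Finset (Site d), U.card ≤ N m ∧ ∀ y ∈ T m, z ∈ box y (k m) → y ∈ U)
    (hq0 : ∀ m, 0 ≤ q m) (hq : ∀ m, (N m : ℝ) ≤ q m * (2 * k m + 1 : ℕ) ^ d) (hQ : HasSum q Q) :
    interaction J α x (⋃ m, T m) ≤ 2 ^ α * Q * interaction J α x S := by
  have h0 : 0 < α := lt_of_le_of_lt (by positivity) hα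
  have hQ0 : 0 ≤ Q := hQ.nonneg hq0
  have hS0 := interaction_nonneg (α := α) hJ x S
  rw [← ENNReal.ofReal_le_ofReal_iff (by positivity), ENNReal.ofReal_mul (by positivity),
    ENNReal.ofReal_mul (by positivity), ofReal_interaction hJ hα, ofReal_interaction hJ hα,
    ← hQ.tsum_eq, ENNReal.ofReal_tsum_of_nonneg hq0 hQ.summable]
  set c : Site d → ENNReal := fun y => ENNReal.ofReal (coupling J α x y) with hc
  calc ∑' y, (⋃ m, T m).indicator c y ≤ ∑' y, ∑' m, (T m).indicator c y := by
        refine ENNReal.tsum_le_tsum fun y => ?_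
        by_cases hy : y ∈ ⋃ m, T m
        · obtain ⟨m, hm⟩ := Set.mem_iUnion.mp hy
          rw [Set.indicator_of_mem hy, ← Set.indicator_of_mem hm c]
          exact ENNReal.le_tsum (f := fun m => (T m).indicator c y) m
        · rw [Set.indicator_of_notMem hy]
          exact zero_le
    _ = ∑' m, ∑' y, (T m).indicator c y := ENNReal.tsum_comm
    _ ≤ ∑' m, ENNReal.ofReal (2 ^ α) * ENNReal.ofReal (q m) * ∑' z, S.indicator c z := by
        refine ENNReal.tsum_le_tsum fun m => tsum_indicator_le_of_sparse c _ (k := k m) ?_ ?_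
        · intro y hy z hz
          obtain ⟨h1, h2, h3⟩ := hbox m y hy z hz
          refine ⟨h1, ?_⟩
          rw [hc]
          dsimp only
          rw [← ENNReal.ofReal_mul (by positivity)]
          exact ENNReal.ofReal_le_ofReal (coupling_le_of_dist1_le hJ h0.le h2 h3)
        · intro z
          obtain ⟨U, hU, hTU⟩ := hcount m z
          calc ∑' y, (T m).indicator (fun y => if z ∈ box y (k m) then (1 : ENNReal) else 0) y
              ≤ ∑' y, if y ∈ U then (1 : ENNReal) else 0 := by
                refine ENNReal.tsum_le_tsum fun y => ?_
                by_cases hy : y ∈ T m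
                · rw [Set.indicator_of_mem hy]
                  by_cases hz : z ∈ box y (k m)
                  · rw [if_pos hz, if_pos (hTU y hy hz)]
                  · rw [if_neg hz]
                    exact zero_le
                · rw [Set.indicator_of_notMem hy]
                  exact zero_le
            _ = U.card := by
                rw [tsum_eq_sum (s := U) (fun y hy => if_neg hy), Finset.sum_ite_mem]
                simp
            _ ≤ ENNReal.ofReal (N m) := by
                rw [ENNReal.ofReal_natCast]
                exact_mod_cast hU
            _ ≤ ENNReal.ofReal (q m * (2 * k m + 1 : ℕ) ^ d) := ENNReal.ofReal_le_ofReal (hq m)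
            _ = _ := by
                rw [ENNReal.ofReal_mul (hq0 m), ENNReal.ofReal_pow (by positivity),
                  ENNReal.ofReal_natCast]
    _ = _ := by
        rw [ENNReal.tsum_mul_right, ENNReal.tsum_mul_left]

/-! ### Separated families -/

/-- Every set in `P` is the union of at most `n` pieces, and distinct sets in `P` are far apart
compared to the diameters of their pieces. -/
structure IsSeparatedFamily (M a : ℝ) (n : ℕ) (P : Finset (Finset (Site d)))
    (fam : Finset (Site d) → Finset (Finset (Site d))) : Prop where
  nonempty : ∀ g ∈ P, g.Nonempty
  fam_nonempty : ∀ g ∈ P, (fam g).Nonempty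
  card_le : ∀ g ∈ P, (fam g).card ≤ n
  sup_eq : ∀ g ∈ P, (fam g).sup id = g
  far : ∀ g ∈ P, ∀ g' ∈ P, g ≠ g' → ∀ x ∈ g, ∀ y ∈ g',
    M * (min (maxDiam (fam g)) (maxDiam (fam g')) : ℝ) ^ a < (dist1 x y : ℝ)

lemma IsMARPartition.exists_isSeparatedFamily {M a r : ℝ} {σ : Config d}
    {P : Finset (Finset (Site d))} (hP : IsMARPartition M a r σ P) :
    ∃ fam, IsSeparatedFamily M a ⌈(2 : ℝ) ^ r⌉₊ P fam := by
  obtain ⟨fam, h1, h2⟩ := hP.separated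
  refine ⟨fam, hP.nonempty, fun g hg => (h1 g hg).1, fun g hg => ?_, fun g hg => (h1 g hg).2.2, h2⟩
  have h := (h1 g hg).2.1
  have h' := Nat.le_ceil ((2 : ℝ) ^ r)
  have : ((fam g).card : ℝ) ≤ (⌈(2 : ℝ) ^ r⌉₊ : ℝ) := by linarith
  exact_mod_cast this

/-- A point separated from `g` by `g'` is farther from `g` than `g'`. -/
lemma lt_dist1_of_not_mem_comp {g g' : Finset (Site d)} {R : ℝ}
    (hR : ∀ x ∈ g, ∀ z ∈ g', R < dist1 x z) {K : Comp (g' : Set (Site d))ᶜ}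
    (hK : (g : Set (Site d)) ⊆ K.sites) {y w : Site d} (hy : y ∉ K.sites) (hw : w ∈ g) :
    R < dist1 w y := by
  obtain ⟨z, hz, h⟩ := exists_mem_geodesic K.adjClosed (hK hw) hy
  refine (hR w hw z hz).trans_le ?_
  exact_mod_cast (by omega : dist1 w z ≤ dist1 w y)

lemma Comp.exists_dist1_le_of_not_mem {g : Finset (Site d)} {C : Comp (g : Set (Site d))ᶜ}
    {y z : Site d} (hy : y ∈ C.sites) (hz : z ∉ C.sites) :
    ∃ w ∈ g, dist1 w y ≤ dist1 y z := by
  obtain ⟨w, hw, h⟩ := exists_mem_geodesic C.adjClosed hy hz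
  exact ⟨w, hw, by rw [dist1_comm]; omega⟩

namespace IsSeparatedFamily

variable {M a : ℝ} {n : ℕ} {P : Finset (Finset (Site d))}
  {fam : Finset (Site d) → Finset (Finset (Site d))}

lemma one_le (h : IsSeparatedFamily M a n P fam) {g : Finset (Site d)} (hg : g ∈ P) : 1 ≤ n :=
  (Finset.card_pos.mpr (h.fam_nonempty g hg)).trans_le (h.card_le g hg)

lemma one_le_diam (h : IsSeparatedFamily M a n P fam) {g : Finset (Site d)} (hg : g ∈ P) :
    1 ≤ maxDiam (fam g) :=
  one_le_maxDiam (h.fam_nonempty g hg)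

lemma far_of_le (h : IsSeparatedFamily M a n P fam) {g g' : Finset (Site d)} (hg : g ∈ P)
    (hg' : g' ∈ P) (hne : g ≠ g') (hle : maxDiam (fam g') ≤ maxDiam (fam g)) {x y : Site d}
    (hx : x ∈ g) (hy : y ∈ g') : M * (maxDiam (fam g') : ℝ) ^ a < dist1 x y := by
  have := h.far g hg g' hg' hne x hx y hy
  rwa [min_eq_right (by exact_mod_cast hle)] at this

lemma far_of_ge (h : IsSeparatedFamily M a n P fam) {g g' : Finset (Site d)} (hg : g ∈ P)
    (hg' : g' ∈ P) (hne : g ≠ g') (hle : maxDiam (fam g) ≤ maxDiam (fam g')) {x y : Site d}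
    (hx : x ∈ g) (hy : y ∈ g') : M * (maxDiam (fam g) : ℝ) ^ a < dist1 x y := by
  have := h.far g hg g' hg' hne x hx y hy
  rwa [min_eq_left (by exact_mod_cast hle)] at this

/-- Points in a bounded component of the complement of a part are close to the part. -/
lemma near_of_finite (hd : 2 ≤ d) (h : IsSeparatedFamily M a n P fam) {g : Finset (Site d)}
    (hg : g ∈ P) (C : Comp (g : Set (Site d))ᶜ) (hC : C.sites.Finite) {y : Site d}
    (hy : y ∈ C.sites) : ∃ z ∈ g, dist1 y z ≤ 2 * n * maxDiam (fam g) := by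
  obtain ⟨z, hz, hyz⟩ := exists_dist1_le_of_finite_comp hd (h.sup_eq g hg) (h.card_le g hg)
    le_rfl C hC hy
  refine ⟨z, hz, hyz.trans ?_⟩
  have := h.one_le_diam hg
  nlinarith

/-- The number of points close to a part. -/
lemma exists_finset_near (h : IsSeparatedFamily M a n P fam) {g : Finset (Site d)}
    (hg : g ∈ P) : ∃ U : Finset (Site d), U.card ≤ n * (7 * n * maxDiam (fam g)) ^ d ∧
      ∀ y, (∃ z ∈ g, dist1 y z ≤ 2 * n * maxDiam (fam g)) → y ∈ U := by
  obtain ⟨U, hU, hU'⟩ := LongRangeIsing.exists_finset_near (h.sup_eq g hg) (h.card_le g hg)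
    (le_refl (maxDiam (fam g))) (2 * n * maxDiam (fam g))
  refine ⟨U, hU.trans (Nat.mul_le_mul_left _ (Nat.pow_le_pow_left ?_ _)), hU'⟩
  have h1 := h.one_le_diam hg
  have h2 := h.one_le hg
  have h3 : maxDiam (fam g) ≤ n * maxDiam (fam g) := Nat.le_mul_of_pos_left _ h2
  nlinarith

lemma mul_cube_le_mul_rpow (hM : 0 ≤ M) (ha : 3 ≤ a) {m : ℕ} (hm : 1 ≤ m) :
    M * (m : ℝ) ^ 3 ≤ M * (m : ℝ) ^ a := by
  refine mul_le_mul_of_nonneg_left ?_ hM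
  rw [← Real.rpow_natCast]
  exact Real.rpow_le_rpow_of_exponent_le (by exact_mod_cast hm) (by simpa using ha)

lemma mul_le_mul_cube (hM : 0 ≤ M) {m : ℕ} (hm : 1 ≤ m) :
    M * (m : ℝ) ≤ M * (m : ℝ) ^ 3 := by
  refine mul_le_mul_of_nonneg_left ?_ hM
  exact le_self_pow₀ (by exact_mod_cast hm) (by norm_num)

/-- A point separated from `g` by a part `g'` of smaller diameter is close to `g'`. -/
lemma near_of_not_mem_comp (hd : 2 ≤ d) (h : IsSeparatedFamily M a n P fam)
    (hM : (8 * n : ℝ) ≤ M) (ha : 3 ≤ a) {g g' : Finset (Site d)} (hg : g ∈ P) (hg' : g' ∈ P)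
    (hne : g ≠ g') (hle : maxDiam (fam g') ≤ maxDiam (fam g)) {K : Comp (g' : Set (Site d))ᶜ}
    (hK : (g : Set (Site d)) ⊆ K.sites) {y : Site d} (hy : y ∉ K.sites) :
    ∃ z ∈ g', dist1 y z ≤ 2 * n * maxDiam (fam g') := by
  have hM0 : 0 ≤ M := le_trans (by positivity) hM
  have hm := h.one_le_diam hg'
  -- If `K` were bounded, `g` would lie within `2 * n * maxDiam (fam g')` of `g'`, against the
  -- separation.
  have hKinf : K.sites.Infinite := by
    intro hfin
    obtain ⟨w, hw⟩ := h.nonempty g hg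
    obtain ⟨z, hz, hwz⟩ := h.near_of_finite hd hg' K hfin (hK hw)
    have h1 := h.far_of_le hg hg' hne hle hw hz
    have h2 := mul_cube_le_mul_rpow hM0 ha hm
    have h3 := mul_le_mul_cube hM0 hm
    have h4 : (dist1 w z : ℝ) ≤ 2 * n * maxDiam (fam g') := by exact_mod_cast hwz
    have h5 : (8 * n : ℝ) * maxDiam (fam g') ≤ M * maxDiam (fam g') := by gcongr
    have h6 : (0 : ℝ) ≤ n * maxDiam (fam g') := by positivity
    nlinarith
  by_cases hyg : y ∈ g'
  · exact ⟨y, hyg, by rw [dist1_self]; exact Nat.zero_le _⟩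
  · obtain ⟨C, hC⟩ := Comp.exists_mem_sites (S := (g' : Set (Site d))ᶜ) (x := y) hyg
    refine h.near_of_finite hd hg' C ?_ hC
    by_contra hinf
    exact hy (Comp.eq_of_infinite hd g'.finite_toSet hinf hKinf ▸ hC)

/-- The points of `S` that are separated from `g` by a part with pieces of diameter `m`, at most
the one of `g`. -/
def shadow (P : Finset (Finset (Site d))) (fam : Finset (Site d) → Finset (Finset (Site d)))
    (g : Finset (Site d)) (S : Set (Site d)) (m : ℕ) : Set (Site d) :=
  {y | y ∈ S ∧ ∃ g' ∈ P, g ≠ g' ∧ maxDiam (fam g') ≤ maxDiam (fam g) ∧ maxDiam (fam g') = m ∧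
    ∃ K : Comp (g' : Set (Site d))ᶜ, (g : Set (Site d)) ⊆ K.sites ∧ y ∉ K.sites}

/-- The points of `S` separated from `g` by a smaller part contribute little to the interaction
of `S` with a point outside of `S`. -/
lemma interaction_shadow_le (hd : 2 ≤ d) {J α : ℝ} (hJ : 0 ≤ J) (hα : (d : ℝ) < α)
    (h : IsSeparatedFamily M a n P fam) (hM : (8 * n : ℝ) ≤ M) (ha : 3 ≤ a)
    {g : Finset (Site d)} (hg : g ∈ P) {S : Set (Site d)} (hSg : S ⊆ (g : Set (Site d))ᶜ)
    (hS : ∀ C : Comp (g : Set (Site d))ᶜ, ∀ y ∈ C.sites, y ∈ S → C.sites ⊆ S)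
    {x : Site d} (hx : x ∉ S) :
    interaction J α x (⋃ m, shadow P fam g S m) ≤
      2 ^ α * (n * (28 * n * d) ^ d / M * ∑' m : ℕ, 1 / (m : ℝ) ^ 2) * interaction J α x S := by
  have hn : (1 : ℝ) ≤ n := by exact_mod_cast h.one_le hg
  have hM1 : 1 ≤ M := by linarith
  have hM0 : 0 ≤ M := by linarith
  have hd0 : (0 : ℝ) < d := by exact_mod_cast (by omega : 0 < d)
  -- A box of radius `k m` has `ℓ¹`-radius at most `M * m ^ 3 / 4`, a quarter of the guaranteed
  -- separation at scale `m`. The exponent 3 is available because `a ≥ 3`.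
  let k : ℕ → ℕ := fun m => ⌊M * (m : ℝ) ^ 3 / (4 * d)⌋₊
  have hk : ∀ m, (d : ℝ) * k m ≤ M * (m : ℝ) ^ 3 / 4 := by
    intro m
    have h1 : (k m : ℝ) ≤ M * (m : ℝ) ^ 3 / (4 * d) := Nat.floor_le (by positivity)
    calc (d : ℝ) * k m ≤ d * (M * (m : ℝ) ^ 3 / (4 * d)) := by gcongr
      _ = M * (m : ℝ) ^ 3 / 4 := by field_simp
  have hk' : ∀ (m : ℕ) (y z : Site d), z ∈ box y (k m) → (dist1 y z : ℝ) ≤ M * (m : ℝ) ^ 3 / 4 := by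
    intro m y z hz
    refine le_trans ?_ (hk m)
    exact_mod_cast dist1_le_of_mem_box hz
  refine interaction_iUnion_le_of_sparse hJ hα x (k := k) (N := fun m => n * (7 * n * m) ^ d)
    (q := fun m => n * (28 * n * d) ^ d / M * (1 / (m : ℝ) ^ 2)) ?_ ?_ ?_ ?_ ?_
  · rintro m y ⟨hyS, g', hg', hne, hle, rfl, K, hK, hyK⟩ z hz
    have hm := h.one_le_diam hg'
    have hfar : ∀ w ∈ g, M * (maxDiam (fam g') : ℝ) ^ 3 < dist1 w y := fun w hw =>
      lt_dist1_of_not_mem_comp (fun u hu v hv => (mul_cube_le_mul_rpow hM0 ha hm).trans_lt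
        (h.far_of_le hg hg' hne hle hu hv)) hK hyK hw
    have hyz := hk' _ y z hz
    have hR : 0 ≤ M * (maxDiam (fam g') : ℝ) ^ 3 := by positivity
    obtain ⟨C, hC⟩ := Comp.exists_mem_sites (hSg hyS)
    have hzS : z ∈ S := by
      refine hS C y hC hyS ?_
      by_contra hzC
      obtain ⟨w, hw, hwy⟩ := Comp.exists_dist1_le_of_not_mem hC hzC
      have h1 := hfar w hw
      have h2 : (dist1 w y : ℝ) ≤ dist1 y z := by exact_mod_cast hwy
      linarith
    refine ⟨hzS, fun e => hx (e ▸ hzS), ?_⟩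
    -- A geodesic from `y` to the outside point `x` crosses `g`, so `x` is farther from `y` than the
    -- box radius. This gives the factor 2 between the distances.
    obtain ⟨w, hw, hwy⟩ := Comp.exists_dist1_le_of_not_mem hC fun hxC => hx (hS C y hC hyS hxC)
    have h1 := hfar w hw
    have h2 : (dist1 w y : ℝ) ≤ dist1 y x := by exact_mod_cast hwy
    have h3 : (dist1 y z : ℝ) ≤ dist1 x y := by
      rw [dist1_comm x y]
      linarith
    have h4 : dist1 y z ≤ dist1 x y := by exact_mod_cast h3
    have := dist1_triangle x y z
    omega
  · intro m z
    by_cases hex : ∃ y ∈ shadow P fam g S m, z ∈ box y (k m)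
    · obtain ⟨y₀, ⟨hyS₀, g₀, hg₀, hne₀, hle₀, rfl, K₀, hK₀, hyK₀⟩, hz₀⟩ := hex
      obtain ⟨U, hU, hU'⟩ := h.exists_finset_near hg₀
      refine ⟨U, hU, ?_⟩
      rintro y ⟨hyS, g₁, hg₁, hne₁, hle₁, hm₁, K₁, hK₁, hyK₁⟩ hz
      obtain ⟨v₁, hv₁, hyv₁⟩ := h.near_of_not_mem_comp hd hM ha hg hg₁ hne₁ hle₁ hK₁ hyK₁
      obtain ⟨v₀, hv₀, hyv₀⟩ := h.near_of_not_mem_comp hd hM ha hg hg₀ hne₀ hle₀ hK₀ hyK₀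
      -- Boxes attached to distinct parts of the same scale are disjoint: otherwise these parts
      -- would be within `4 * n * m + M * m ^ 3 / 2 ≤ M * m ^ 3`. So the overlap count involves the
      -- surroundings of one part only.
      rcases eq_or_ne g₁ g₀ with rfl | hne
      · exact hU' y ⟨v₁, hv₁, hyv₁⟩
      · exfalso
        have hm := h.one_le_diam hg₀
        have h1 := (mul_cube_le_mul_rpow hM0 ha hm).trans_lt
          (h.far_of_le hg₁ hg₀ hne hm₁.ge hv₁ hv₀)
        rw [hm₁] at hyv₁
        have h2 := hk' _ y z hz
        have h3 := hk' _ y₀ z hz₀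
        have h4 : (dist1 v₁ v₀ : ℝ) ≤ dist1 y v₁ + dist1 y z + dist1 y₀ z + dist1 y₀ v₀ := by
          have t1 := dist1_triangle v₁ y v₀
          have t2 := dist1_triangle y z v₀
          have t3 := dist1_triangle z y₀ v₀
          rw [dist1_comm v₁ y] at t1
          rw [dist1_comm z y₀] at t3
          exact_mod_cast (by omega :
            dist1 v₁ v₀ ≤ dist1 y v₁ + dist1 y z + dist1 y₀ z + dist1 y₀ v₀)
        have h5 : (dist1 y v₁ : ℝ) ≤ 2 * n * maxDiam (fam g₀) := by exact_mod_cast hyv₁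
        have h6 : (dist1 y₀ v₀ : ℝ) ≤ 2 * n * maxDiam (fam g₀) := by exact_mod_cast hyv₀
        have h7 : (8 * n : ℝ) * maxDiam (fam g₀) ≤ M * maxDiam (fam g₀) := by gcongr
        have h8 := mul_le_mul_cube hM0 hm
        linarith
    · exact ⟨∅, by simp, fun y hy hz => absurd ⟨y, hy, hz⟩ hex⟩
  · intro m
    positivity
  · intro m
    -- At `m = 0` both sides vanish, by `1 / 0 = 0` and `d ≠ 0`.
    rcases Nat.eq_zero_or_pos m with rfl | hm
    · have hd' : d ≠ 0 := by omega
      simp [hd']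
    have hm1 : (1 : ℝ) ≤ m := by exact_mod_cast hm
    set t : ℝ := M * (m : ℝ) ^ 3 / (4 * d) with ht
    have ht0 : 0 ≤ t := by positivity
    have h1 : t ≤ ((2 * k m + 1 : ℕ) : ℝ) := by
      have := (Nat.lt_floor_add_one t).le
      have h0 : (0 : ℝ) ≤ (k m : ℝ) := by positivity
      push_cast
      change t ≤ 2 * (⌊t⌋₊ : ℝ) + 1
      change (0 : ℝ) ≤ (⌊t⌋₊ : ℝ) at h0
      linarith
    have h2 : t ^ d ≤ ((2 * k m + 1 : ℕ) : ℝ) ^ d := pow_le_pow_left₀ ht0 h1 d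
    -- Box side against part size leaves the density `(M * m ^ 2) ^ (-d)`, which is at most `1 / (M
    -- * m ^ 2)`: summable in `m` and small in `M`.
    have h3 : (28 * n * d : ℝ) ^ d * t ^ d = (7 * n * m) ^ d * (M * (m : ℝ) ^ 2) ^ d := by
      rw [← mul_pow, ← mul_pow]
      congr 1
      rw [ht]
      field_simp
      ring
    have h4 : M * (m : ℝ) ^ 2 ≤ (M * (m : ℝ) ^ 2) ^ d :=
      le_self_pow₀ (one_le_mul_of_one_le_of_one_le hM1 (one_le_pow₀ hm1)) (by omega)
    calc ((n * (7 * n * m) ^ d : ℕ) : ℝ) = n * (7 * n * m) ^ d * (M * (m : ℝ) ^ 2)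
          / M * (1 / (m : ℝ) ^ 2) := by
          push_cast
          field_simp
      _ ≤ n * (7 * n * m) ^ d * (M * (m : ℝ) ^ 2) ^ d / M * (1 / (m : ℝ) ^ 2) := by gcongr
      _ = n * (28 * n * d) ^ d / M * (1 / (m : ℝ) ^ 2) * t ^ d := by
          rw [mul_assoc (n : ℝ), ← h3]
          ring
      _ ≤ _ := by gcongr
  · exact (Real.summable_one_div_nat_pow.mpr (by norm_num)).hasSum.mul_left _

end IsSeparatedFamily

/-! ### Sums over pairs of sites -/

lemma hasSum_rows (F : Site d → Site d → ℝ) (S : Finset (Site d)) (h0 : ∀ x, x ∉ S → ∀ y, F x y = 0)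
    (hF : ∀ x ∈ S, Summable (F x)) :
    HasSum (fun p : Site d × Site d => F p.1 p.2) (∑ x ∈ S, ∑' y, F x y) := by
  have h : ∀ x ∈ S, HasSum (fun p : Site d × Site d => if p.1 = x then F p.1 p.2 else 0)
      (∑' y, F x y) := by
    intro x hx
    rw [← (Prod.mk_right_injective x).hasSum_iff]
    · simpa [Function.comp_def] using (hF x hx).hasSum
    · rintro ⟨u, v⟩ hp
      refine if_neg fun e => hp ⟨v, ?_⟩
      simpa using e.symm
  convert hasSum_sum h using 1
  funext p
  rw [Finset.sum_ite_eq]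
  split_ifs with hp
  · rfl
  · exact h0 _ hp _

lemma hasSum_swap {F : Site d → Site d → ℝ} {v : ℝ}
    (h : HasSum (fun p : Site d × Site d => F p.1 p.2) v) :
    HasSum (fun p : Site d × Site d => F p.2 p.1) v :=
  (Equiv.prodComm (Site d) (Site d)).hasSum_iff.mpr h

lemma hasSum_columns (F : Site d → Site d → ℝ) (S : Finset (Site d))
    (h0 : ∀ x, x ∉ S → ∀ y, F x y = 0) (hF : ∀ x ∈ S, Summable (F x)) :
    HasSum (fun p : Site d × Site d => F p.2 p.1) (∑ x ∈ S, ∑' y, F x y) :=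
  hasSum_swap (hasSum_rows F S h0 hF)

/-- The coupling restricted to `x ∈ S` and `y ∈ T x`. -/
def restrictedCoupling (J α : ℝ) (S : Finset (Site d)) (T : Site d → Set (Site d))
    (x y : Site d) : ℝ :=
  if x ∈ S then (T x).indicator (coupling J α x) y else 0

lemma hasSum_restrictedCoupling {J α : ℝ} (hα : (d : ℝ) < α) (S : Finset (Site d))
    (T : Site d → Set (Site d)) :
    HasSum (fun p : Site d × Site d => restrictedCoupling J α S T p.1 p.2)
      (∑ x ∈ S, interaction J α x (T x)) := by
  have h := hasSum_rows (restrictedCoupling J α S T) S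
    (fun x hx y => if_neg hx)
    (fun x hx => by
      have : restrictedCoupling J α S T x = (T x).indicator (coupling J α x) :=
        funext fun y => if_pos hx
      rw [this]
      exact summable_interaction hα x (T x))
  convert h using 1
  refine Finset.sum_congr rfl fun x hx => tsum_congr fun y => (if_pos hx).symm

lemma hasSum_restrictedCoupling_swap {J α : ℝ} (hα : (d : ℝ) < α) (S : Finset (Site d))
    (T : Site d → Set (Site d)) :
    HasSum (fun p : Site d × Site d => restrictedCoupling J α S T p.2 p.1)
      (∑ x ∈ S, interaction J α x (T x)) :=
  hasSum_swap (hasSum_restrictedCoupling hα S T)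

lemma sum_interaction_comm {J α : ℝ} (S T : Finset (Site d)) :
    ∑ x ∈ S, interaction J α x T = ∑ x ∈ T, interaction J α x S := by
  have h : ∀ (x : Site d) (T : Finset (Site d)),
      interaction J α x T = ∑ y ∈ T, coupling J α x y := by
    intro x T
    unfold interaction
    rw [tsum_eq_sum (s := T) fun y hy => Set.indicator_of_notMem (by simpa using hy) _]
    exact Finset.sum_congr rfl fun y hy => Set.indicator_of_mem (by simpa using hy) _
  simp only [h]
  rw [Finset.sum_comm]
  exact Finset.sum_congr rfl fun x _ => Finset.sum_congr rfl fun y _ => coupling_comm J α y x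

lemma surfaceEnergy_coe (J α : ℝ) (S : Finset (Site d)) :
    surfaceEnergy J α (S : Set (Site d)) =
      ∑ x ∈ S, interaction J α x (S : Set (Site d))ᶜ := by
  unfold surfaceEnergy interaction
  rw [← Finset.tsum_subtype']
  exact tsum_congr fun x => tsum_subtype _ _

lemma spin_eq (s : ℤˣ) : s = 1 ∧ spin s = 1 ∨ s = -1 ∧ spin s = -1 := by
  rcases Int.units_eq_one_or s with rfl | rfl
  · exact .inl ⟨rfl, by simp [spin]⟩
  · exact .inr ⟨rfl, by simp [spin]⟩

/-! ### The energy difference -/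

lemma hamiltonianMinus_eq {J α : ℝ} {Λ : Finset (Site d)} {σ : Config d}
    (hσ : σ ∈ configsMinus Λ) :
    hamiltonianMinus J α Λ σ =
      -((1 / 2 : ℝ) * ∑ x ∈ Λ, ∑ y ∈ Λ, coupling J α x y * (spin (σ x) * spin (σ y)))
      - ∑ x ∈ Λ, ∑' y, ((Λ : Set (Site d))ᶜ).indicator
          (fun y => coupling J α x y * (spin (σ x) * spin (σ y))) y := by
  unfold hamiltonianMinus hamiltonian
  simp only [zero_mul, Finset.sum_const_zero, sub_zero, mul_assoc]
  congr 1
  refine Finset.sum_congr rfl fun x _ => ?_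
  rw [← tsum_subtype]
  refine tsum_congr fun y => ?_
  rw [hσ y y.2]

/-- Twice the energy difference of two configurations as a sum over ordered pairs. -/
lemma hasSum_hamiltonianMinus_sub {J α : ℝ} (hα : (d : ℝ) < α) {Λ : Finset (Site d)}
    {σ τ : Config d} (hσ : σ ∈ configsMinus Λ) (hτ : τ ∈ configsMinus Λ) :
    HasSum (fun p : Site d × Site d => coupling J α p.1 p.2 *
        (spin (τ p.1) * spin (τ p.2) - spin (σ p.1) * spin (σ p.2)))
      (2 * (hamiltonianMinus J α Λ σ - hamiltonianMinus J α Λ τ)) := by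
  have hs : ∀ (ρ : Config d) (x : Site d),
      Summable fun y => coupling J α x y * (spin (ρ x) * spin (ρ y)) := by
    intro ρ x
    refine Summable.of_norm_bounded (summable_coupling (J := J) hα x).norm fun y => ?_
    rcases spin_eq (ρ x) with ⟨_, h1⟩ | ⟨_, h1⟩ <;> rcases spin_eq (ρ y) with ⟨_, h2⟩ | ⟨_, h2⟩ <;>
      simp [h1, h2]
  set k : Site d → Site d → ℝ := fun x y =>
    coupling J α x y * (spin (τ x) * spin (τ y) - spin (σ x) * spin (σ y)) with hk
  have hksum : ∀ x, Summable (k x) := by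
    intro x
    simpa only [hk, mul_sub] using (hs τ x).sub (hs σ x)
  have hkcomm : ∀ x y, k x y = k y x := by
    intro x y
    simp only [hk, coupling_comm J α x y, mul_comm]
  have h1 := hasSum_rows (fun x y => if x ∈ Λ then k x y else 0) Λ
    (fun x hx y => if_neg hx) (fun x hx => by simpa only [if_pos hx] using hksum x)
  have h2 := hasSum_columns
    (fun x y => if x ∈ Λ then ((Λ : Set (Site d))ᶜ).indicator (k x) y else 0) Λ
    (fun x hx y => if_neg hx) (fun x hx => by
      simpa only [if_pos hx] using (hksum x).indicator _)
  have h := h1.add h2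
  have hval : 2 * (hamiltonianMinus J α Λ σ - hamiltonianMinus J α Λ τ) =
      ∑ x ∈ Λ, ∑' y, (if x ∈ Λ then k x y else 0) +
      ∑ x ∈ Λ, ∑' y, (if x ∈ Λ then ((Λ : Set (Site d))ᶜ).indicator (k x) y else 0) := by
    have e1 : ∀ x ∈ Λ, ∑' y, (if x ∈ Λ then k x y else 0) = ∑ y ∈ Λ, k x y +
        ∑' y, ((Λ : Set (Site d))ᶜ).indicator (k x) y := by
      intro x hx
      simp only [if_pos hx]
      have hadd := ((hksum x).indicator (Λ : Set (Site d))).tsum_add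
        ((hksum x).indicator (Λ : Set (Site d))ᶜ)
      rw [tsum_congr (fun y => Set.indicator_self_add_compl_apply (Λ : Set (Site d)) (k x) y)]
        at hadd
      rw [hadd, tsum_eq_sum (s := Λ) fun y hy => Set.indicator_of_notMem (by simpa using hy) _]
      congr 1
      exact Finset.sum_congr rfl fun y hy => Set.indicator_of_mem (by simpa using hy) _
    have e2 : ∀ x ∈ Λ, ∑' y, (if x ∈ Λ then ((Λ : Set (Site d))ᶜ).indicator (k x) y else 0)
        = ∑' y, ((Λ : Set (Site d))ᶜ).indicator (k x) y := fun x hx => by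
      simp only [if_pos hx]
    have e3 : ∀ x, ∑' y, ((Λ : Set (Site d))ᶜ).indicator (k x) y =
        ∑' y, ((Λ : Set (Site d))ᶜ).indicator
          (fun y => coupling J α x y * (spin (τ x) * spin (τ y))) y -
        ∑' y, ((Λ : Set (Site d))ᶜ).indicator
          (fun y => coupling J α x y * (spin (σ x) * spin (σ y))) y := by
      intro x
      rw [← ((hs τ x).indicator _).tsum_sub ((hs σ x).indicator _)]
      refine tsum_congr fun y => ?_
      by_cases hy : y ∈ (Λ : Set (Site d))ᶜ
      · simp only [Set.indicator_of_mem hy, hk, mul_sub]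
      · simp only [Set.indicator_of_notMem hy, sub_zero]
    rw [Finset.sum_congr rfl e1, Finset.sum_congr rfl e2, Finset.sum_add_distrib,
      Finset.sum_congr rfl fun x _ => e3 x, Finset.sum_sub_distrib,
      hamiltonianMinus_eq hσ, hamiltonianMinus_eq hτ]
    simp only [hk, mul_sub, Finset.sum_sub_distrib]
    ring
  rw [hval]
  convert h using 1
  funext p
  by_cases h1 : p.1 ∈ Λ
  · have : p.1 ∉ ((Λ : Set (Site d))ᶜ) := by simpa using h1
    rw [if_pos h1, Set.indicator_of_notMem this, ite_self, add_zero]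
  · have h1' : p.1 ∈ ((Λ : Set (Site d))ᶜ) := by simpa using h1
    rw [if_neg h1, Set.indicator_of_mem h1', zero_add]
    by_cases h2 : p.2 ∈ Λ
    · rw [if_pos h2, hkcomm p.2 p.1]
    · rw [if_neg h2, hσ _ h1, hσ _ h2, hτ _ h1, hτ _ h2, sub_self, mul_zero]

/-- The energy gained by setting `σ` to `-1` on `I` and flipping it on `A`, up to the errors from
the sites in `A` with spin `-1` and the sites outside of `I ∪ A` with spin `+1`. -/
lemma le_hamiltonianMinus_sub {J α : ℝ} (hJ : 0 ≤ J) (hα : (d : ℝ) < α) {Λ I A : Finset (Site d)}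
    {σ τ : Config d} (hσ : σ ∈ configsMinus Λ) (hτ : τ ∈ configsMinus Λ) (hIA : Disjoint I A)
    (hτI : ∀ x ∈ I, τ x = -1) (hτA : ∀ x ∈ A, τ x = -σ x)
    (hτB : ∀ x, x ∉ I → x ∉ A → τ x = σ x) {DA : Finset (Site d)}
    {B DB : Set (Site d)} (hB : B = {x | x ∉ I ∧ x ∉ A}) (hDA : DA = A.filter (σ · = -1))
    (hDB : DB = {x | (x ∉ I ∧ x ∉ A) ∧ σ x = 1}) :
    ∑ x ∈ I, interaction J α x {y | σ y ≠ σ x} + 2 * ∑ x ∈ A, interaction J α x B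
      - 2 * ∑ x ∈ I, interaction J α x (DA ∪ DB)
      - 4 * ∑ x ∈ DA, interaction J α x B
      - 4 * ∑ x ∈ A, interaction J α x DB
      ≤ hamiltonianMinus J α Λ σ - hamiltonianMinus J α Λ τ := by
  have hD := (hasSum_hamiltonianMinus_sub (J := J) hα hσ hτ).mul_left (1 / 2)
  -- All terms except the one for `I` are symmetrized, so the bound can be checked for each ordered
  -- pair separately. The term for `I` is left unsymmetrized because it already counts pairs inside
  -- `I` in both orders.
  have hw := (((((hasSum_restrictedCoupling (J := J) hα I fun x => {y | σ y ≠ σ x}).add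
    ((hasSum_restrictedCoupling (J := J) hα A fun _ => B).add
      (hasSum_restrictedCoupling_swap (J := J) hα A fun _ => B))).sub
    ((hasSum_restrictedCoupling (J := J) hα I fun _ => DA ∪ DB).add
      (hasSum_restrictedCoupling_swap (J := J) hα I fun _ => DA ∪ DB))).sub
    (((hasSum_restrictedCoupling (J := J) hα DA fun _ => B).add
      (hasSum_restrictedCoupling_swap (J := J) hα DA fun _ => B)).mul_left 2)).sub
    (((hasSum_restrictedCoupling (J := J) hα A fun _ => DB).add
      (hasSum_restrictedCoupling_swap (J := J) hα A fun _ => DB)).mul_left 2))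
  refine le_trans (le_of_eq ?_) ((hasSum_le ?_ hw hD).trans (le_of_eq ?_))
  · ring
  · rintro ⟨x, y⟩
    have hc := coupling_nonneg (α := α) hJ x y
    have hxI : x ∈ I → x ∉ A := fun h => Finset.disjoint_left.mp hIA h
    have hyI : y ∈ I → y ∉ A := fun h => Finset.disjoint_left.mp hIA h
    have hτx : τ x = if x ∈ I then -1 else if x ∈ A then -σ x else σ x := by
      split_ifs with h1 h2
      exacts [hτI x h1, hτA x h2, hτB x h1 h2]
    have hτy : τ y = if y ∈ I then -1 else if y ∈ A then -σ y else σ y := by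
      split_ifs with h1 h2
      exacts [hτI y h1, hτA y h2, hτB y h1 h2]
    have hne : (1 : ℤˣ) ≠ -1 := by decide
    have e1 : spin (1 : ℤˣ) = 1 := by simp [spin]
    have e2 : spin (-1 : ℤˣ) = -1 := by simp [spin]
    simp only [restrictedCoupling, Set.indicator_apply, hB, hDA, hDB, Set.mem_union,
      Set.mem_ofPred_eq, Finset.mem_coe, Finset.mem_filter, hτx, hτy, coupling_comm J α y x]
    by_cases x1 : x ∈ I <;> by_cases x2 : x ∈ A <;>
      first
      | exact absurd x2 (hxI x1)
      | by_cases y1 : y ∈ I <;> by_cases y2 : y ∈ A <;>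
          first
          | exact absurd y2 (hyI y1)
          | rcases Int.units_eq_one_or (σ x) with h1 | h1 <;>
              rcases Int.units_eq_one_or (σ y) with h2 | h2 <;>
              simp [x1, x2, y1, y2, h1, h2, hne, hne.symm, e1, e2] <;> linarith
  · ring

/-! ### The energy of the support -/

/-- A site `y` agreeing with `x` disagrees with the neighbour `u` of `x`. Passing from `x` to `u` at
most doubles the distance to `y`, whence `2 ^ α`, and each `u` serves at most `3 ^ d` sites `x`. -/
lemma sum_interaction_univ_le {J α : ℝ} (hJ : 0 ≤ J) (hα : (d : ℝ) < α) {I : Finset (Site d)}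
    {σ : Config d} (hI : ∀ x ∈ I, ∃ u ∈ I, dist1 x u = 1 ∧ σ u ≠ σ x) :
    ∑ x ∈ I, interaction J α x Set.univ ≤
      2 ^ α * 3 ^ d * ∑ x ∈ I, interaction J α x {y | σ y ≠ σ x} := by
  have h0 : 0 < α := lt_of_le_of_lt (by positivity) hα
  have hrow : ∀ x ∈ I, interaction J α x Set.univ ≤
      ∑ u ∈ I, if u ∈ box x 1 then 2 ^ α * interaction J α u {y | σ y ≠ σ u} else 0 := by
    intro x hx
    rw [← Finset.sum_filter]
    have hs : ∀ u ∈ I.filter (· ∈ box x 1), Summable fun y =>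
        2 ^ α * ({y | σ y ≠ σ u} : Set (Site d)).indicator (coupling J α u) y := fun u _ =>
      (summable_interaction hα u _).mul_left _
    unfold interaction
    simp only [← tsum_mul_left]
    rw [← Summable.tsum_finsetSum hs]
    refine (summable_interaction hα x _).tsum_le_tsum (fun y => ?_) (summable_sum hs)
    rw [Set.indicator_univ]
    have key : ∃ u ∈ I.filter (· ∈ box x 1), coupling J α x y ≤
        2 ^ α * ({y | σ y ≠ σ u} : Set (Site d)).indicator (coupling J α u) y := by
      have hxx : x ∈ I.filter (· ∈ box x 1) := Finset.mem_filter.mpr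
        ⟨hx, mem_box_of_dist1_le (by simp [dist1_self])⟩
      have h2 : (1 : ℝ) ≤ 2 ^ α := Real.one_le_rpow (by norm_num) h0.le
      by_cases hy : σ y = σ x
      · rcases eq_or_ne x y with rfl | hxy
        · refine ⟨x, hxx, ?_⟩
          have : coupling J α x x = 0 := if_pos rfl
          rw [this]
          exact mul_nonneg (by positivity)
            (Set.indicator_nonneg (fun y _ => coupling_nonneg hJ x y) _)
        · obtain ⟨u, hu, hxu, hσu⟩ := hI x hx
          refine ⟨u, Finset.mem_filter.mpr ⟨hu, mem_box_of_dist1_le hxu.le⟩, ?_⟩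
          have hyu : σ y ≠ σ u := by rw [hy]; exact Ne.symm hσu
          rw [Set.indicator_of_mem (by exact hyu)]
          refine coupling_le_of_dist1_le hJ h0.le (fun e => hyu (by rw [e])) ?_
          have t1 := dist1_triangle u x y
          have t2 := dist1_pos hxy
          rw [dist1_comm u x] at t1
          omega
      · refine ⟨x, hxx, ?_⟩
        rw [Set.indicator_of_mem (by exact hy)]
        exact le_mul_of_one_le_left (coupling_nonneg hJ x y) h2
    obtain ⟨u, hu, hle⟩ := key
    refine hle.trans (Finset.single_le_sum (f := fun u =>
      2 ^ α * ({y | σ y ≠ σ u} : Set (Site d)).indicator (coupling J α u) y) (fun u _ => ?_) hu)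
    exact mul_nonneg (by positivity) (Set.indicator_nonneg (fun y _ => coupling_nonneg hJ u y) _)
  refine (Finset.sum_le_sum hrow).trans ?_
  rw [Finset.sum_comm, Finset.mul_sum]
  refine Finset.sum_le_sum fun u _ => ?_
  rw [← Finset.sum_filter, Finset.sum_const, nsmul_eq_mul]
  have hcard : ((I.filter fun x => u ∈ box x 1).card : ℝ) ≤ 3 ^ d := by
    have h1 : (I.filter fun x => u ∈ box x 1) ⊆ box u 1 := fun x hx =>
      mem_box_comm.mp (Finset.mem_filter.mp hx).2
    have h2 := Finset.card_le_card h1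
    rw [card_box] at h2
    exact_mod_cast h2
  have := interaction_nonneg (α := α) hJ u {y | σ y ≠ σ u}
  calc _ ≤ 3 ^ d * (2 ^ α * interaction J α u {y | σ y ≠ σ u}) := by gcongr
    _ = _ := by ring

/-! ### Energy estimates for a contour -/

lemma boundary_finite_of_mem_configsMinus {Λ : Finset (Site d)} {σ : Config d}
    (hσ : σ ∈ configsMinus Λ) : (boundary σ).Finite := by
  refine (Λ.biUnion fun y => box y 1).finite_toSet.subset fun x hx => ?_
  have h := hx.2
  unfold IsCorrect at h
  push Not at h
  obtain ⟨y, hxy, hy⟩ := h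
  refine Finset.mem_coe.mpr (Finset.mem_biUnion.mpr ⟨y, ?_, ?_⟩)
  · by_contra hyΛ
    exact hy (hσ y hyΛ)
  · exact mem_box_of_dist1_le (by rw [dist1_comm]; exact hxy)

lemma IsMARPartition.exists_adj_ne {M a r : ℝ} {σ : Config d} {P : Finset (Finset (Site d))}
    (hP : IsMARPartition M a r σ P) (hM : 2 ≤ M) (ha : 0 ≤ a) {g : Finset (Site d)} (hg : g ∈ P)
    {x : Site d} (hx : x ∈ g) : ∃ u ∈ g, dist1 x u = 1 ∧ σ u ≠ σ x := by
  have hb := hP.subset_boundary hg hx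
  have h : ¬ IsCorrect σ (σ x) x := by
    rcases Int.units_eq_one_or (σ x) with h | h <;> rw [h]
    exacts [hb.1, hb.2]
  unfold IsCorrect at h
  push Not at h
  obtain ⟨u, hxu, hu⟩ := h
  have hne : x ≠ u := fun e => hu (by rw [e])
  have h1 := dist1_pos hne
  refine ⟨u, ?_, by omega, hu⟩
  exact hP.mem_part_of_near hM ha hg hx
    (mem_boundary_of_ne (by rw [dist1_comm]; exact hxu) hu) (by omega)

/-- Symmetry of the coupling turns the sum over `S` into one over `T`, which may be infinite, so
estimates can be made at each point of `T`. -/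
lemma sum_interaction_eq_tsum {J α : ℝ} (hα : (d : ℝ) < α) (S : Finset (Site d))
    (T : Set (Site d)) :
    HasSum (T.indicator fun y => interaction J α y S) (∑ x ∈ S, interaction J α x T) := by
  have h : HasSum _ (∑ x ∈ S, interaction J α x T) :=
    hasSum_sum fun x _ => (summable_interaction hα x T).hasSum
  convert h using 1
  funext y
  by_cases hy : y ∈ T
  · simp only [Set.indicator_of_mem hy]
    have := sum_interaction_comm (J := J) (α := α) S {y}
    simp only [Finset.sum_singleton] at this
    rw [← this]
    refine Finset.sum_congr rfl fun x _ => ?_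
    unfold interaction
    rw [tsum_eq_single y fun z hz => Set.indicator_of_notMem (by simpa using hz) _]
    simp
  · simp only [Set.indicator_of_notMem hy, Finset.sum_const_zero]

/-- Restricting `S` to a subset that interacts little with every point of `T`. -/
lemma sum_interaction_le_of_forall {J α κ : ℝ} (hα : (d : ℝ) < α) {S S' : Finset (Site d)}
    {T : Set (Site d)} (h : ∀ y ∈ T, interaction J α y S' ≤ κ * interaction J α y S) :
    ∑ x ∈ S', interaction J α x T ≤ κ * ∑ x ∈ S, interaction J α x T := by
  refine hasSum_le (fun y => ?_) (sum_interaction_eq_tsum hα S' T)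
    ((sum_interaction_eq_tsum hα S T).mul_left κ)
  by_cases hy : y ∈ T
  · simpa only [Set.indicator_of_mem hy] using h y hy
  · simp only [Set.indicator_of_notMem hy, mul_zero, le_refl]

/-- The energy estimate with explicit error terms. -/
lemma IsSeparatedFamily.energy_le (hd : 2 ≤ d) {J α β : ℝ} (hJ : 0 ≤ J) (hβ : (d : ℝ) < β)
    (hβα : β ≤ α) {M a r : ℝ} {n : ℕ} {Λ A : Finset (Site d)} {σ τ : Config d}
    {P : Finset (Finset (Site d))} {fam : Finset (Site d) → Finset (Finset (Site d))}
    (hP : IsMARPartition M a r σ P) (h : IsSeparatedFamily M a n P fam) (hM : (8 * n : ℝ) ≤ M)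
    (ha : 3 ≤ a) (had : (d : ℝ) ≤ a * (α - β)) {g : Finset (Site d)} (hg : g ∈ P)
    (hσ : σ ∈ configsMinus Λ) (hτ : τ ∈ configsMinus Λ)
    (hout : ∀ C : Comp (g : Set (Site d))ᶜ, C.sites.Infinite → labelOf σ g C = -1)
    (hA : ∀ x, x ∈ A ↔ ∃ C : Comp (g : Set (Site d))ᶜ,
      (C.sites.Finite ∧ labelOf σ g C = 1) ∧ x ∈ C.sites)
    (hτg : ∀ x ∈ g, τ x = -1) (hτA : ∀ x ∈ A, τ x = -σ x)
    (hτB : ∀ x, x ∉ g → x ∉ A → τ x = σ x)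
    {κ δ : ℝ} (hκ : κ = 2 ^ α * (n * (28 * n * d) ^ d / M * ∑' m : ℕ, 1 / (m : ℝ) ^ 2))
    (hδ : δ = J * (∑' y : Site d, (dist1 0 y : ℝ) ^ (-β)) * M ^ (-(α - β))) :
    ∑ x ∈ g, interaction J α x {y | σ y ≠ σ x}
      + (2 - 8 * κ) * ∑ x ∈ A, interaction J α x {x | x ∉ g ∧ x ∉ A}
      - (2 + 4 * (n * (7 * n) ^ d)) * δ * g.card
      ≤ hamiltonianMinus J α Λ σ - hamiltonianMinus J α Λ τ := by
  have hα : (d : ℝ) < α := hβ.trans_le hβα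
  have hn : (1 : ℝ) ≤ n := by exact_mod_cast h.one_le hg
  have hM2 : 2 ≤ M := by linarith
  have hM0 : 0 < M := by linarith
  have ha0 : 0 ≤ a := by linarith
  have hm := h.one_le_diam hg
  have hm1 : (1 : ℝ) ≤ maxDiam (fam g) := by exact_mod_cast hm
  have hAg : ∀ x ∈ A, x ∉ g := fun x hx => by
    obtain ⟨C, _, hxC⟩ := (hA x).mp hx
    exact C.sites_subset hxC
  have hgA : Disjoint g A := Finset.disjoint_right.mpr hAg
  set B : Set (Site d) := {x | x ∉ g ∧ x ∉ A} with hB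
  set DA : Finset (Site d) := A.filter (σ · = -1) with hDA
  set DB : Set (Site d) := {x | (x ∉ g ∧ x ∉ A) ∧ σ x = 1} with hDB
  have hunits : (1 : ℤˣ) ≠ -1 := by decide
  -- the sites with the wrong sign are separated from `g` by another part
  have hsepA : ∀ y ∈ DA, ∃ g' ∈ P, g ≠ g' ∧ ∃ K : Comp (g' : Set (Site d))ᶜ,
      (g : Set (Site d)) ⊆ K.sites ∧ y ∉ K.sites := by
    intro y hy
    obtain ⟨hyA, hy⟩ := Finset.mem_filter.mp hy
    obtain ⟨C, ⟨_, hl⟩, hyC⟩ := (hA y).mp hyA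
    exact hP.exists_separating_part_of_ne_label hd hM2 ha0 hg C hyC
      (by rw [hy, hl]; exact hunits.symm)
  have hsepB : ∀ y ∈ DB, ∃ g' ∈ P, g ≠ g' ∧ ∃ K : Comp (g' : Set (Site d))ᶜ,
      (g : Set (Site d)) ⊆ K.sites ∧ y ∉ K.sites := by
    rintro y ⟨⟨hyg, hyA⟩, hy⟩
    obtain ⟨C, hyC⟩ := Comp.exists_mem_sites (S := (g : Set (Site d))ᶜ) (x := y) hyg
    refine hP.exists_separating_part_of_ne_label hd hM2 ha0 hg C hyC ?_
    rw [hy]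
    intro hl
    by_cases hC : C.sites.Infinite
    · exact hunits (hl.trans (hout C hC))
    · exact hyA ((hA y).mpr ⟨C, ⟨Set.not_infinite.mp hC, hl.symm⟩, hyC⟩)
  have hfar : ∀ y ∈ (DA : Set (Site d)) ∪ DB, ∀ x ∈ g, M ≤ dist1 x y := by
    intro y hy x hx
    obtain ⟨g', hg', hne, K, hK, hyK⟩ : ∃ g' ∈ P, g ≠ g' ∧ ∃ K : Comp (g' : Set (Site d))ᶜ,
      (g : Set (Site d)) ⊆ K.sites ∧ y ∉ K.sites := hy.elim (hsepA y) (hsepB y)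
    exact (lt_dist1_of_not_mem_comp
      (fun u hu v hv => hP.lt_dist1 hM0.le ha0 hg hg' hne hu hv) hK hyK hx).le
  have hfar' : ∀ g' ∈ P, g ≠ g' → maxDiam (fam g) ≤ maxDiam (fam g') →
      ∀ K : Comp (g' : Set (Site d))ᶜ, (g : Set (Site d)) ⊆ K.sites → ∀ y, y ∉ K.sites →
      ∀ x ∈ g, M * (maxDiam (fam g) : ℝ) ^ a < dist1 x y := by
    intro g' hg' hne hle K hK y hyK x hx
    exact lt_dist1_of_not_mem_comp
      (fun u hu v hv => h.far_of_ge hg hg' hne hle hu hv) hK hyK hx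
  have hAclosed : ∀ C : Comp (g : Set (Site d))ᶜ, ∀ y ∈ C.sites, y ∈ (A : Set (Site d)) →
      C.sites ⊆ (A : Set (Site d)) := by
    intro C y hyC hyA z hzC
    obtain ⟨C', hC', hyC'⟩ := (hA y).mp hyA
    obtain rfl := Comp.eq_of_mem hyC hyC'
    exact (hA z).mpr ⟨C, hC', hzC⟩
  have hBclosed : ∀ C : Comp (g : Set (Site d))ᶜ, ∀ y ∈ C.sites, y ∈ B → C.sites ⊆ B := by
    intro C y hyC hyB z hzC
    exact ⟨C.sites_subset hzC, fun hzA => hyB.2 (hAclosed C z hzC hzA hyC)⟩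
  -- the wrong sites in `A`
  have hDAs : (DA : Set (Site d)) ⊆ ⋃ m, shadow P fam g A m := by
    intro y hy
    obtain ⟨g', hg', hne, K, hK, hyK⟩ := hsepA y hy
    have hyA : y ∈ A := (Finset.mem_filter.mp hy).1
    rcases le_or_gt (maxDiam (fam g')) (maxDiam (fam g)) with hle | hlt
    · exact Set.mem_iUnion.mpr ⟨_, hyA, g', hg', hne, hle, rfl, K, hK, hyK⟩
    -- A larger part is more than `M * maxDiam (fam g) ^ a` away from `g`, but bounded components
    -- stay within `2 * n * maxDiam (fam g)` of it.
    · exfalso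
      obtain ⟨C, ⟨hC, _⟩, hyC⟩ := (hA y).mp hyA
      obtain ⟨z, hz, hyz⟩ := h.near_of_finite hd hg C hC hyC
      have h1 := hfar' g' hg' hne hlt.le K hK y hyK z hz
      have h2 := mul_cube_le_mul_rpow hM0.le ha hm
      have h3 := mul_le_mul_cube hM0.le hm
      have h4 : (dist1 z y : ℝ) ≤ 2 * n * maxDiam (fam g) := by
        rw [dist1_comm]
        exact_mod_cast hyz
      have h5 : (8 * n : ℝ) * maxDiam (fam g) ≤ M * maxDiam (fam g) := by gcongr
      have h6 : (0 : ℝ) < n * maxDiam (fam g) := by positivity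
      linarith
  have hEA : ∑ x ∈ DA, interaction J α x B ≤ κ * ∑ x ∈ A, interaction J α x B := by
    refine sum_interaction_le_of_forall hα fun y hy => ?_
    have h1 := h.interaction_shadow_le hd hJ hα hM ha hg (S := A) (x := y) hAg hAclosed hy.2
    rw [← hκ] at h1
    exact (interaction_mono hJ hα y hDAs).trans h1
  -- the wrong sites in `B`
  set DB₂ : Set (Site d) := {y | y ∈ B ∧ ∃ g' ∈ P, g ≠ g' ∧ maxDiam (fam g) ≤ maxDiam (fam g') ∧
    ∃ K : Comp (g' : Set (Site d))ᶜ, (g : Set (Site d)) ⊆ K.sites ∧ y ∉ K.sites} with hDB₂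
  have hDBs : DB ⊆ (⋃ m, shadow P fam g B m) ∪ DB₂ := by
    intro y hy
    obtain ⟨g', hg', hne, K, hK, hyK⟩ := hsepB y hy
    rcases le_total (maxDiam (fam g')) (maxDiam (fam g)) with hle | hle
    · exact .inl (Set.mem_iUnion.mpr ⟨_, hy.1, g', hg', hne, hle, rfl, K, hK, hyK⟩)
    · exact .inr ⟨hy.1, g', hg', hne, hle, K, hK, hyK⟩
  have hDB₂far : ∀ x ∈ A, ∀ y ∈ DB₂, M * (maxDiam (fam g) : ℝ) ^ a ≤ dist1 x y := by
    rintro x hx y ⟨hyB, g', hg', hne, hle, K, hK, hyK⟩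
    obtain ⟨C, hyC⟩ := Comp.exists_mem_sites (S := (g : Set (Site d))ᶜ) (x := y) hyB.1
    obtain ⟨w, hw, hwy⟩ := Comp.exists_dist1_le_of_not_mem hyC
      fun hxC => (hBclosed C y hyC hyB hxC).2 hx
    refine (hfar' g' hg' hne hle K hK y hyK w hw).le.trans ?_
    rw [dist1_comm x y]
    exact_mod_cast hwy
  set Z : ℝ := J * ∑' y : Site d, (dist1 0 y : ℝ) ^ (-β) with hZ
  have hZ0 : 0 ≤ Z := mul_nonneg hJ (tsum_nonneg fun _ => by positivity)
  have hδ0 : 0 ≤ δ := by rw [hδ]; positivity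
  have hcardA : (A.card : ℝ) ≤ n * (7 * n) ^ d * (maxDiam (fam g) : ℝ) ^ d := by
    obtain ⟨U, hU, hU'⟩ := h.exists_finset_near hg
    have hsub : A ⊆ U := fun x hx => by
      obtain ⟨C, ⟨hC, _⟩, hxC⟩ := (hA x).mp hx
      exact hU' x (h.near_of_finite hd hg C hC hxC)
    have h1 : (A.card : ℝ) ≤ n * (7 * n * maxDiam (fam g)) ^ d := by
      exact_mod_cast (Finset.card_le_card hsub).trans hU
    rwa [mul_pow, ← mul_assoc] at h1
  -- With `a * (α - β) ≥ d`, each site of `A` contributes at most `δ * maxDiam (fam g) ^ (-d)`,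
  -- which cancels the volume bound on `A`.
  have hE₂ : ∑ x ∈ A, interaction J α x DB₂ ≤ n * (7 * n) ^ d * δ := by
    have hR : 0 < M * (maxDiam (fam g) : ℝ) ^ a := by positivity
    have h1 : ∀ x ∈ A, interaction J α x DB₂ ≤ δ * ((maxDiam (fam g) : ℝ) ^ d)⁻¹ := by
      intro x hx
      refine (interaction_le_of_far hJ hβ hβα hR (hDB₂far x hx)).trans ?_
      rw [Real.mul_rpow hM0.le (by positivity), ← mul_assoc, ← hZ, ← hδ]
      refine mul_le_mul_of_nonneg_left ?_ hδ0
      rw [← Real.rpow_mul (by positivity), ← Real.rpow_natCast, ← Real.rpow_neg (by positivity)]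
      exact Real.rpow_le_rpow_of_exponent_le hm1 (by linarith)
    refine (Finset.sum_le_sum h1).trans ?_
    rw [Finset.sum_const, nsmul_eq_mul]
    calc (A.card : ℝ) * (δ * ((maxDiam (fam g) : ℝ) ^ d)⁻¹)
        ≤ n * (7 * n) ^ d * (maxDiam (fam g) : ℝ) ^ d
          * (δ * ((maxDiam (fam g) : ℝ) ^ d)⁻¹) := by gcongr
      _ = n * (7 * n) ^ d * δ := by field_simp
  have hEB : ∑ x ∈ A, interaction J α x DB ≤
      κ * ∑ x ∈ A, interaction J α x B + n * (7 * n) ^ d * δ := by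
    have h1 : ∀ x ∈ A, interaction J α x DB ≤
        κ * interaction J α x B + interaction J α x DB₂ := by
      intro x hx
      refine (interaction_mono hJ hα x hDBs).trans ((interaction_union_le hJ hα x _ _).trans ?_)
      have h2 := h.interaction_shadow_le hd hJ hα hM ha hg (S := B) (x := x) (fun y hy => hy.1)
        hBclosed (fun hxB => hxB.2 hx)
      rw [← hκ] at h2
      linarith
    refine (Finset.sum_le_sum h1).trans ?_
    rw [Finset.sum_add_distrib, ← Finset.mul_sum]
    linarith
  -- the wrong sites and `g`
  have hEg : ∑ x ∈ g, interaction J α x (DA ∪ DB) ≤ δ * g.card := by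
    have h1 : ∀ x ∈ g, interaction J α x (DA ∪ DB) ≤ δ := fun x hx => by
      rw [hδ]
      exact interaction_le_of_far hJ hβ hβα hM0 fun y hy => hfar y hy x hx
    refine (Finset.sum_le_sum h1).trans ?_
    rw [Finset.sum_const, nsmul_eq_mul, mul_comm]
  have hmain := le_hamiltonianMinus_sub hJ hα hσ hτ hgA hτg hτA hτB hB hDA hDB
  have hgcard : (1 : ℝ) ≤ g.card := by
    exact_mod_cast Finset.card_pos.mpr (h.nonempty g hg)
  have hlast : n * (7 * n) ^ d * δ ≤ n * (7 * n) ^ d * δ * g.card :=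
    le_mul_of_one_le_right (by positivity) hgcard
  have hsum : (2 + 4 * (n * (7 * n) ^ d)) * δ * g.card =
      2 * (δ * g.card) + 4 * (n * (7 * n) ^ d * δ * g.card) := by ring
  rw [hsum, sub_mul, mul_assoc 8]
  linarith

/-! ### Exponents, surface energies and the size of `M` -/

lemma three_le_aParam (hd : 2 ≤ d) {α ε : ℝ} (hε : 0 < ε) : 3 ≤ aParam d α ε := by
  refine le_trans ?_ (le_max_right _ _)
  have : (2 : ℝ) ≤ d := by exact_mod_cast hd
  linarith

/-- For `β = d + (α - d) / (d + 1)` one has `α - β = (α - d) * d / (d + 1)`, and the first entry of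
the maximum suffices. -/
lemma le_aParam_mul {α ε : ℝ} (hα : (d : ℝ) < α) (hε : 0 < ε) :
    (d : ℝ) ≤ aParam d α ε * (α - (d + (α - d) / (d + 1))) := by
  have h1 : 0 < α - d := by linarith
  have h2 : (0 : ℝ) ≤ d := by positivity
  have h3 : α - (d + (α - d) / (d + 1)) = (α - d) * (d / (d + 1)) := by
    field_simp
    ring
  rw [h3]
  have h4 : (d + 1 + ε) / (α - d) ≤ aParam d α ε := le_max_left _ _
  have h5 : 0 ≤ (α - d) * (d / (d + 1)) := by positivity
  refine le_trans ?_ (mul_le_mul_of_nonneg_right h4 h5)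
  have h6 : (d + 1 + ε) / (α - d) * ((α - d) * (d / (d + 1))) = d * ((d + 1 + ε) / (d + 1)) := by
    field_simp
  rw [h6]
  refine le_mul_of_one_le_right h2 ?_
  rw [one_le_div (by positivity)]
  linarith

/-- Couplings from `A` to its complement end either in `g`, and are then part of the surface energy
of `g`, or outside `g ∪ A`. -/
lemma surfaceEnergy_le_add {J α : ℝ} (hJ : 0 ≤ J) (hα : (d : ℝ) < α) (g A : Finset (Site d))
    (hgA : Disjoint g A) :
    surfaceEnergy J α (A : Set (Site d)) ≤
      ∑ x ∈ A, interaction J α x {x | x ∉ g ∧ x ∉ A} + surfaceEnergy J α (g : Set (Site d)) := by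
  rw [surfaceEnergy_coe, surfaceEnergy_coe]
  have h1 : ∑ x ∈ A, interaction J α x (A : Set (Site d))ᶜ ≤
      ∑ x ∈ A, interaction J α x {x | x ∉ g ∧ x ∉ A} + ∑ x ∈ A, interaction J α x g := by
    rw [← Finset.sum_add_distrib]
    refine Finset.sum_le_sum fun x _ =>
      (interaction_mono hJ hα x fun y hy => ?_).trans (interaction_union_le hJ hα x _ _)
    by_cases hyg : y ∈ g
    · exact .inr hyg
    · exact .inl ⟨hyg, hy⟩
  rw [sum_interaction_comm] at h1
  refine h1.trans (add_le_add_right (Finset.sum_le_sum fun x _ =>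
    interaction_mono hJ hα x fun y hy => ?_) _)
  exact Finset.disjoint_right.mp hgA hy

/-- For large `M` the error terms are small. -/
lemma exists_forall_error_le (u v η c : ℝ) (n : ℕ) (hη : 0 < η) (hc : 0 < c) :
    ∃ M₀ : ℝ, 0 < M₀ ∧ ∀ M : ℝ, M₀ ≤ M → (8 * n : ℝ) ≤ M ∧ u / M ≤ 1 / 8 ∧
      v * M ^ (-η) ≤ c := by
  have h1 : ∀ᶠ M : ℝ in Filter.atTop, u / M ≤ 1 / 8 :=
    (tendsto_const_nhds.div_atTop Filter.tendsto_id).eventually_le_const (by norm_num)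
  have h2 : ∀ᶠ M : ℝ in Filter.atTop, v * M ^ (-η) ≤ c := by
    have := (tendsto_rpow_neg_atTop hη).const_mul v
    rw [mul_zero] at this
    exact this.eventually_le_const hc
  obtain ⟨M₁, hM₁⟩ := Filter.eventually_atTop.mp
    ((Filter.eventually_ge_atTop (8 * n : ℝ)).and (h1.and h2))
  exact ⟨max M₁ 1, by positivity, fun M hM => hM₁ M ((le_max_left _ _).trans hM)⟩

end LongRangeIsing

end

theorem proposition4p5 (d : ℕ) (hd : 2 ≤ d) (α : ℝ) (hα : (d : ℝ) < α) (J : ℝ) (hJ : 0 < J) :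
    ∃ c₂ c₃ c₄ : ℝ, 0 < c₂ ∧ 0 < c₃ ∧ 0 < c₄ ∧
      ∀ ε : ℝ, 0 < ε → ∃ M₀ : ℝ, 0 < M₀ ∧ ∀ M : ℝ, M₀ ≤ M →
        ∀ Γ : LongRangeIsing.Config d → Finset (Finset (LongRangeIsing.Site d)),
          LongRangeIsing.IsPartitionChoice M (LongRangeIsing.aParam d α ε)
            (LongRangeIsing.rParam d α ε) Γ →
          ∀ (Λ : Finset (LongRangeIsing.Site d)) (γ : LongRangeIsing.Contour d),
            {γ} ∈ LongRangeIsing.externalFamilies Γ (-1) Λ →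
            ∀ σ ∈ LongRangeIsing.configsWith Γ Λ {γ},
              c₂ * (γ.sp.card : ℝ)
                  + c₃ * LongRangeIsing.surfaceEnergy J α (γ.interior 1)
                  + c₄ * LongRangeIsing.surfaceEnergy J α (γ.sp : Set (LongRangeIsing.Site d))
                ≤ LongRangeIsing.hamiltonianMinus J α Λ σ
                  - LongRangeIsing.hamiltonianMinus J α Λ (LongRangeIsing.erase {γ} σ) := by
  open LongRangeIsing in
  set c : ℝ := (2 ^ α * 3 ^ d)⁻¹ with hc
  have hc0 : 0 < c := by positivity
  refine ⟨c * J / 4, min 1 (c / 4), c / 4, by positivity, by positivity, by positivity,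
    fun ε hε => ?_⟩
  set β : ℝ := d + (α - d) / (d + 1) with hβdef
  have hαd : 0 < α - d := by linarith
  have hdpos : (0 : ℝ) < d := by exact_mod_cast (by omega : 0 < d)
  have hβ : (d : ℝ) < β := by
    have : 0 < (α - d) / (d + 1) := by positivity
    linarith
  have hβα : β < α := by
    have : (α - d) / (d + 1) < α - d := div_lt_self hαd (by linarith)
    linarith
  -- The bound on the number of pieces depends on `ε` through `r`. It affects only the threshold for
  -- `M`, not the three constants.
  set n : ℕ := ⌈(2 : ℝ) ^ rParam d α ε⌉₊ with hn
  set S : ℝ := ∑' y : Site d, (dist1 0 y : ℝ) ^ (-β) with hS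
  set ζ : ℝ := ∑' m : ℕ, 1 / (m : ℝ) ^ 2 with hζ
  obtain ⟨M₀, hM₀, hM₀'⟩ := exists_forall_error_le (2 ^ α * (n * (28 * n * d) ^ d * ζ))
    ((2 + 4 * (n * (7 * n) ^ d)) * (J * S)) (α - β) (c * J / 4) n (by linarith) (by positivity)
  refine ⟨M₀, hM₀, fun M hM Γ hΓ Λ γ hγ σ hσ => ?_⟩
  obtain ⟨hM8, hMκ, hMδ⟩ := hM₀' M hM
  obtain ⟨hσΛ, hσγ⟩ := hσ
  obtain ⟨-, hlab, hvol⟩ := hγ.2 γ rfl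
  have hP := hΓ σ (boundary_finite_of_mem_configsMinus hσΛ)
  obtain ⟨g, hg, hγeq⟩ := hσγ (Set.mem_singleton γ)
  have hgP : g ∈ Γ σ := hg
  subst hγeq
  obtain ⟨fam, hfam⟩ := hP.exists_isSeparatedFamily
  set γ : Contour d := ⟨g, labelOf σ g⟩ with hγdef
  have hint : ∀ x, x ∈ γ.interior 1 ↔ ∃ C : Comp (g : Set (Site d))ᶜ,
      (C.sites.Finite ∧ labelOf σ g C = 1) ∧ x ∈ C.sites := by
    intro x
    simp only [Contour.interior, Set.mem_iUnion, Set.mem_ofPred_eq, exists_prop]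
    exact Iff.rfl
  have hspΛ : ∀ x ∈ g, x ∈ Λ := fun x hx => hvol (.inl hx)
  have hintΛ : ∀ x ∈ γ.interior 1, x ∈ Λ := fun x hx => hvol (.inr (.inl hx))
  obtain ⟨A, hAcoe⟩ : ∃ A : Finset (Site d), γ.interior 1 = (A : Set (Site d)) :=
    ⟨(Λ.finite_toSet.subset hintΛ).toFinset, (Set.Finite.coe_toFinset _).symm⟩
  have hAmem : ∀ x, x ∈ A ↔ x ∈ γ.interior 1 := fun x => by rw [hAcoe, Finset.mem_coe]
  have hA : ∀ x, x ∈ A ↔ ∃ C : Comp (g : Set (Site d))ᶜ,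
      (C.sites.Finite ∧ labelOf σ g C = 1) ∧ x ∈ C.sites := fun x => (hAmem x).trans (hint x)
  have hgA : Disjoint g A := Finset.disjoint_right.mpr fun x hx => by
    obtain ⟨C, _, hxC⟩ := (hA x).mp hx
    exact C.sites_subset hxC
  have hτ : ∀ x, erase {γ} σ x = if x ∈ g then -1 else if x ∈ A then -σ x else σ x := by
    intro x
    have h1 : (x ∈ ⋃ γ' ∈ ({γ} : Set (Contour d)), (γ'.sp : Set (Site d))) ↔ x ∈ g := by
      simp [hγdef]
    have h2 : (x ∈ ⋃ γ' ∈ ({γ} : Set (Contour d)), γ'.interior 1) ↔ x ∈ A := by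
      simp [hAmem]
    unfold erase
    split_ifs <;> first | rfl | (exfalso; tauto)
  have hτΛ : erase {γ} σ ∈ configsMinus Λ := by
    intro x hx
    rw [hτ, if_neg fun h => hx (hspΛ x h), if_neg fun h => hx (hintΛ x ((hAmem x).mp h))]
    exact hσΛ x hx
  have hE := IsSeparatedFamily.energy_le hd hJ.le hβ hβα.le hP hfam hM8 (three_le_aParam hd hε)
    (le_aParam_mul hα hε) hgP hσΛ hτΛ hlab hA (fun x hx => by rw [hτ, if_pos hx])
    (fun x hx => by rw [hτ, if_neg (Finset.disjoint_right.mp hgA hx), if_pos hx])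
    (fun x hx hx' => by rw [hτ, if_neg hx, if_neg hx']) rfl rfl
  rw [← hS, ← hζ, ← hn] at hE
  have hM1 : 0 < M := hM₀.trans_le hM
  set κ : ℝ := 2 ^ α * (n * (28 * n * d) ^ d / M * ζ) with hκ
  have hκ8 : κ ≤ 1 / 8 := by
    refine le_trans (le_of_eq ?_) hMκ
    rw [hκ]
    ring
  set E : ℝ := ∑ x ∈ A, interaction J α x {x | x ∉ g ∧ x ∉ A} with hEdef
  have hE0 : 0 ≤ E := Finset.sum_nonneg fun x _ => interaction_nonneg hJ.le x _
  set L : ℝ := ∑ x ∈ g, interaction J α x {y | σ y ≠ σ x} with hL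
  have hM2 : 2 ≤ M := by
    have : (1 : ℝ) ≤ n := by exact_mod_cast hfam.one_le hgP
    linarith
  have ha0 : 0 ≤ aParam d α ε := by linarith [three_le_aParam (α := α) hd hε]
  have hLsum : c * ∑ x ∈ g, interaction J α x Set.univ ≤ L := by
    rw [hc, inv_mul_le_iff₀ (by positivity)]
    exact sum_interaction_univ_le hJ.le hα fun x hx => hP.exists_adj_ne hM2 ha0 hgP hx
  have hU1 : J * g.card ≤ ∑ x ∈ g, interaction J α x Set.univ := by
    rw [mul_comm, ← nsmul_eq_mul, ← Finset.sum_const]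
    exact Finset.sum_le_sum fun x _ => le_interaction_univ (by omega) hJ.le hα x
  have hU2 : surfaceEnergy J α (g : Set (Site d)) ≤ ∑ x ∈ g, interaction J α x Set.univ := by
    rw [surfaceEnergy_coe]
    exact Finset.sum_le_sum fun x _ => interaction_mono hJ.le hα x (Set.subset_univ _)
  have hF := surfaceEnergy_le_add hJ.le hα g A hgA
  rw [← hEdef] at hF
  have hFg : 0 ≤ surfaceEnergy J α (g : Set (Site d)) := by
    rw [surfaceEnergy_coe]
    exact Finset.sum_nonneg fun x _ => interaction_nonneg hJ.le x _
  have hδ : (2 + 4 * (n * (7 * n) ^ d)) * (J * S * M ^ (-(α - β))) * g.card ≤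
      c * J / 4 * g.card := by
    refine mul_le_mul_of_nonneg_right ?_ (by positivity)
    rw [← mul_assoc]
    exact hMδ
  have hκE : E ≤ (2 - 8 * κ) * E := le_mul_of_one_le_left hE0 (by linarith)
  have hc3 : min 1 (c / 4) * surfaceEnergy J α (A : Set (Site d)) ≤
      E + c / 4 * surfaceEnergy J α (g : Set (Site d)) := by
    calc _ ≤ min 1 (c / 4) * (E + surfaceEnergy J α (g : Set (Site d))) := by gcongr
      _ = min 1 (c / 4) * E + min 1 (c / 4) * surfaceEnergy J α (g : Set (Site d)) := by ring
      _ ≤ 1 * E + c / 4 * surfaceEnergy J α (g : Set (Site d)) := by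
          gcongr
          · exact min_le_left _ _
          · exact min_le_right _ _
      _ = _ := by ring
  rw [hAcoe]
  -- Half of `c` times the total interaction of `g` pays for `|g|`, including the error `c * J / 4 *
  -- |g|`. The other half pays for the surface energy of `g`, a quarter directly and a quarter
  -- through that of `A`.
  have h1 := mul_le_mul_of_nonneg_left hU1 hc0.le
  have h2 := mul_le_mul_of_nonneg_left hU2 hc0.le
  change c * J / 4 * (g.card : ℝ) + min 1 (c / 4) * surfaceEnergy J α (A : Set (Site d))
    + c / 4 * surfaceEnergy J α (g : Set (Site d)) ≤ _
  linarith
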